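/- Setting. Let $d\in\{2,3\}$, $N\in\mathbb N$, $\Delta t>0$, $t^n=n\Delta t$, $\epsilon>0$, $\mu>0$. Let $\hat\Omega\subset\mathbb R^d$ be a polyhedral reference domain with a conforming triangulation into simplices $\hat K$, and for $0\le n\le N$ let $\mathcal A_{h,t^n}$ be an ALE map that is affine on every $\hat K$. For $\theta\in[0,1]$ and $n<N$ the linear interpolant in time $\mathcal A_{h,t^n+\theta\Delta t}=\theta\mathcal A_{h,t^{n+1}}+(1-\theta)\mathcal A_{h,t^n}$ is injective on $\overline{\hat\Omega}$. Put $\Omega_t=\mathcal A_{h,t}(\hat\Omega)$, $\mathcal T_{t}=\{\mathcal A_{h,t}(\hat K)\}$, $\mathcal A_{s,t}=\mathcal A_{h,t}\circ\mathcal A_{h,s}^{-1}$, and let $J_{\mathcal A_{s,t}}$ be the Jacobian determinant of $\mathcal A_{s,t}$. For $t\in[t^n,t^{n+1}]$ the mesh velocity on $\Omega_t$ is $\mathbf w_h=\frac1{\Delta t}(\mathcal A_{h,t^{n+1}}-\mathcal A_{h,t^n})\circ\mathcal A_{h,t}^{-1}$, and $\mathbf w_h^{n+1}$ denotes its value at $t=t^{n+1}$.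 A function on $\Omega_{t^m}$ is regarded as a function on $\Omega_{t^n}$ by composition with $\mathcal A_{t^n,t^m}$. Let $V_h^n$ be the space of continuous functions on $\overline{\Omega_{t^n}}$ that vanish on $\partial\Omega_{t^n}$ and are polynomials of degree at most $k$ on each $K\in\mathcal T_{t^n}$. At the levels $t^1,\dots,t^N$ let $\mathbf b$ be bounded and locally Lipschitz, $c\in L^\infty$, $f\in L^2$ on $\Omega_{t^n}$, and write $f^n=f(t^n,\cdot)$. For $n\ge1$ set $$a^n_{SUPG}(u,v)=\epsilon(\nabla u,\nabla v)_{\Omega_{t^n}}+(\mathbf b\cdot\nabla u,v)_{\Omega_{t^n}}+(cu,v)_{\Omega_{t^n}}+\sum_{K\in\mathcal T_{t^n}}\delta_K\big(-\epsilon\Delta u+(\mathbf b-\mathbf w_h^n)\cdot\nabla u+cu,(\mathbf b-\mathbf w_h^n)\cdot\nabla v\big)_K,$$ $$\ell^n(v)=(f^n,v)_{\Omega_{t^n}}+\sum_{K\in\mathcal T_{t^n}}\delta_K\big(f^n,(\mathbf b-\mathbf w_h^n)\cdot\nabla v\big)_K,$$ $$|||u|||_n^2=\epsilon\|\nabla u\|^2_{L^2(\Omega_{t^n})}+\sum_{K\in\mathcal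 T_{t^n}}\delta_K\|(\mathbf b-\mathbf w_h^n)\cdot\nabla u\|^2_{L^2(K)}+\mu\|u\|^2_{L^2(\Omega_{t^n})}.$$ Let $u_h^n\in V_h^n$ ($0\le n\le N$) satisfy the BDF-2 ALE-SUPG scheme: for $1\le n<N$ and all $v_h\in V_h^{n+1}$, $$\Big(\frac{\tfrac32u_h^{n+1}-2u_h^n+\tfrac12u_h^{n-1}}{\Delta t},v_h\Big)_{\Omega_{t^{n+1}}}+a^{n+1}_{SUPG}(u_h^{n+1},v_h)-\int_{\Omega_{t^{n+1}}}\mathbf w_h^{n+1}\cdot\nabla u_h^{n+1}\,v_h\,dx=\ell^{n+1}(v_h).$$ Put $$\alpha_1^n=\|\nabla\cdot\mathbf w_h^n\|_{L^\infty(\Omega_{t^n})}\ (1\le n\le N),\qquad \alpha_2^n=\sup_{t\in(t^n,t^{n+1})}\|J_{\mathcal A_{t^n,t^{n+1}}}\nabla\cdot\mathbf w_h\|_{L^\infty(\Omega_t)}\ (0\le n<N),$$ with $\alpha_1^0=0$ and $\alpha_2^N=0$. Lemma (stability of the BDF-2 ALE-SUPG scheme in non-conservative form). At the levels $t^1,\dots,t^N$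 assume that $c-\tfrac12\nabla\cdot\mathbf b\ge\mu$ a.e. in $\Omega_{t^n}$ and that, for all $K\in\mathcal T_{t^n}$, $$0\le\delta_K\le\frac{\mu}{2\|c\|_{K,\infty}^2},\qquad \delta_K\le\frac{h_K^2}{2\epsilon c_{inv}^2},\qquad\delta_K\le\frac{\Delta t}4$$ (a bound with zero denominator being void), where $h_K=\operatorname{diam}K$ and $c_{inv}$ is a constant of the inverse inequality $\|\Delta v_h\|_{L^2(K)}\le c_{inv}h_K^{-1}\|\nabla v_h\|_{L^2(K)}$, $v_h\in V_h^n$. Assume further that $\Delta t\,(2\alpha_1^n+\alpha_2^n)<1$ for $0\le n\le N$, and put $$G_{n+1}=\exp\Big(\Delta t\sum_{i=1}^{n+1}\frac{2\alpha_1^i+\alpha_2^i}{1-\Delta t(2\alpha_1^i+\alpha_2^i)}\Big).$$ (a) For arbitrary starting values $u_h^0\in V_h^0$, $u_h^1\in V_h^1$ and all $0\le n<N$, $$\|u_h^{n+1}\|^2_{L^2(\Omega_{t^{n+1}})}+\|2u_h^{n+1}-u_h^n\|^2_{L^2(\Omega_{t^{n+1}})}+\Delta t\sum_{i=2}^{n+1}|||u_h^i|||_i^2$$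 $$\le\Big(\tfrac12(1+\Delta t\,\alpha_2^0)\|u_h^0\|^2_{L^2(\Omega_{t^0})}+\tfrac32\|2u_h^1-u_h^0\|^2_{L^2(\Omega_{t^1})}+2\Delta t\sum_{i=2}^{n+1}\Big(\frac2\mu+\frac{\Delta t}2\Big)\|f^i\|^2_{L^2(\Omega_{t^i})}\Big)G_{n+1}.$$ (b) If $u_h^1$ is computed by one step of the implicit Euler scheme, i.e. for all $v_h\in V_h^1$ $$\Big(\frac{u_h^1-u_h^0}{\Delta t},v_h\Big)_{\Omega_{t^1}}+a^1_{SUPG}(u_h^1,v_h)-\int_{\Omega_{t^1}}\mathbf w_h^1\cdot\nabla u_h^1\,v_h\,dx=\ell^1(v_h),$$ then for all $0\le n<N$ $$\|u_h^{n+1}\|^2_{L^2(\Omega_{t^{n+1}})}+\|2u_h^{n+1}-u_h^n\|^2_{L^2(\Omega_{t^{n+1}})}+\frac{\Delta t}2|||u_h^1|||_1^2+\Delta t\sum_{i=2}^{n+1}|||u_h^i|||_i^2$$ $$\le\Big((1+\Delta t\,\alpha_2^0)\|u_h^0\|^2_{L^2(\Omega_{t^0})}+\|2u_h^1-u_h^0\|^2_{L^2(\Omega_{t^1})}+2\Delta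 t\sum_{i=1}^{n+1}\Big(\frac2\mu+\frac{\Delta t}2\Big)\|f^i\|^2_{L^2(\Omega_{t^i})}\Big)G_{n+1}.$$ -/

import Mathlib

open MeasureTheory Set
open scoped BigOperators ENNReal

noncomputable section

namespace ALESUPG

/-- The Euclidean space `ℝ^d`. -/
abbrev Space (d : ℕ) : Type := EuclideanSpace ℝ (Fin d)

/-- The divergence of a vector field. -/
def divergence {d : ℕ} (F : Space d → Space d) (x : Space d) : ℝ :=
  ∑ i : Fin d, fderiv ℝ F x (EuclideanSpace.single i 1) i

/-- A conforming (face-to-face) triangulation into `d`-simplices; a cell is given by its set of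
`d + 1` vertices. -/
structure Triangulation (d : ℕ) where
  cells : Finset (Finset (Space d))
  card_eq : ∀ K ∈ cells, K.card = d + 1
  affineIndependent : ∀ K ∈ cells, AffineIndependent ℝ (fun p : K => (p : Space d))
  inter_eq : ∀ K ∈ cells, ∀ L ∈ cells,
    convexHull ℝ (K : Set (Space d)) ∩ convexHull ℝ (L : Set (Space d)) =
      convexHull ℝ ((K : Set (Space d)) ∩ (L : Set (Space d)))

/-- The closed polyhedral region covered by the simplices. -/
def Triangulation.region {d : ℕ} (T : Triangulation d) : Set (Space d) :=
  ⋃ K ∈ T.cells, convexHull ℝ (K : Set (Space d))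

/-- The discrete ALE motion on the time levels `t^0, …, t^N`: a triangulated reference domain and
the maps `map n = 𝒜_{h,t^n}`, affine on every (closed) reference cell, so continuous on the
closed reference domain. The linear interpolants in time of two consecutive maps are bijections
of the closed reference domain onto their images. -/
structure ALEMotion (d N : ℕ) where
  ref : Triangulation d
  map : ℕ → Space d → Space d
  piecewiseAffine : ∀ n ≤ N, ∀ K ∈ ref.cells, ∃ g : Space d →ᵃ[ℝ] Space d,
    EqOn (map n) g (convexHull ℝ (K : Set (Space d)))
  injOn : ∀ n < N, ∀ θ ∈ Icc (0 : ℝ) 1,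
    InjOn (fun Y => θ • map (n + 1) Y + (1 - θ) • map n Y) ref.region

namespace ALEMotion

variable {d N : ℕ} (M : ALEMotion d N)

/-- The time-discrete ALE map at the time `t^n + θ Δt`, `θ ∈ [0,1]`. -/
def interp (n : ℕ) (θ : ℝ) (Y : Space d) : Space d :=
  θ • M.map (n + 1) Y + (1 - θ) • M.map n Y

/-- The inverse of `interp n θ`, from the moved domain to the reference domain. -/
def interpInv (n : ℕ) (θ : ℝ) : Space d → Space d :=
  Function.invFunOn (M.interp n θ) M.ref.region

/-- The inverse of `map n`, from the moved domain to the reference domain. -/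
def mapInv (n : ℕ) : Space d → Space d :=
  Function.invFunOn (M.map n) M.ref.region

/-- The domain `Ω_{t^n}`. -/
def domain (n : ℕ) : Set (Space d) := M.map n '' interior M.ref.region

/-- The domain `Ω_t` at the time `t = t^n + θ Δt`. -/
def interpDomain (n : ℕ) (θ : ℝ) : Set (Space d) := M.interp n θ '' interior M.ref.region

/-- The (closed) cell of the triangulation at time `t^n` with reference cell `K`. -/
def cell (n : ℕ) (K : Finset (Space d)) : Set (Space d) :=
  M.map n '' convexHull ℝ (K : Set (Space d))

/-- The ALE map `𝒜_{t^m,t^n} : Ω_{t^m} → Ω_{t^n}`. A function `v` on `Ω_{t^n}` is regarded as a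
function on `Ω_{t^m}` by means of `v ∘ transfer m n`. -/
def transfer (m n : ℕ) : Space d → Space d := M.map n ∘ M.mapInv m

/-- The Jacobian determinant of `𝒜_{t^n,t^{n+1}}`, a function on `Ω_{t^n}`. -/
def jacobian (n : ℕ) (x : Space d) : ℝ := (fderiv ℝ (M.transfer n (n + 1)) x).det

/-- The mesh velocity `w_h` on `Ω_t`, `t = t^n + θ Δt`: on the reference domain it is
`(map (n+1) - map n) / Δt`. -/
def stepVelocity (Δt : ℝ) (n : ℕ) (θ : ℝ) (x : Space d) : Space d :=
  Δt⁻¹ • (M.map (n + 1) (M.interpInv n θ x) - M.map n (M.interpInv n θ x))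

/-- The mesh velocity `w_h^n` on `Ω_{t^n}`, for `n ≥ 1`. No mesh velocity belongs to `n = 0`. -/
def velocity (Δt : ℝ) : ℕ → Space d → Space d
  | 0 => 0
  | n + 1 => M.stepVelocity Δt n 1

/-- `α₁^n = ‖∇·w_h(t^n)‖_{L^∞(Ω_{t^n})}`, with `α₁^0 = 0`. -/
def alpha₁ (Δt : ℝ) : ℕ → ℝ
  | 0 => 0
  | n + 1 => (eLpNorm (divergence (M.velocity Δt (n + 1))) ⊤
      (volume.restrict (M.domain (n + 1)))).toReal

/-- `α₂^n = sup_{t ∈ (t^n,t^{n+1})} ‖J_{𝒜_{t^n,t^{n+1}}} ∇·w_h‖_{L^∞(Ω_t)}` for `n < N`, with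
`J` transported to `Ω_t` by the ALE map; `α₂^N = 0`, there being no motion after the final time. -/
def alpha₂ (Δt : ℝ) (n : ℕ) : ℝ :=
  if n < N then
    (⨆ θ ∈ Ioo (0 : ℝ) 1,
      eLpNorm (fun x => M.jacobian n (M.map n (M.interpInv n θ x)) *
          divergence (M.stepVelocity Δt n θ) x) ⊤
        (volume.restrict (M.interpDomain n θ))).toReal
  else 0

/-- The conforming finite element space `V_h` at time `t^n`: continuous functions on the closed
domain that vanish on its boundary and are polynomials of degree at most `k` on every cell. -/
def feSpace (k n : ℕ) : Set (Space d → ℝ) :=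
  {v | ContinuousOn v (closure (M.domain n)) ∧ (∀ x ∈ frontier (M.domain n), v x = 0) ∧
    ∀ K ∈ M.ref.cells, ∃ p : MvPolynomial (Fin d) ℝ, p.totalDegree ≤ k ∧
      ∀ x ∈ M.cell n K, v x = MvPolynomial.eval (fun i => x i) p}

/-- The square of the norm of `L²(Ω_{t^n})`. -/
def normSq (n : ℕ) (v : Space d → ℝ) : ℝ := ∫ x in M.domain n, v x ^ 2

/-- `cinv` is a constant of the inverse inequality `‖Δv‖_{0,K} ≤ cinv h_K⁻¹ |v|_{1,K}` on the
finite element spaces of the time levels `t^1, …, t^N`. -/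
def IsInverseConstant (k : ℕ) (cinv : ℝ) : Prop :=
  ∀ n, 1 ≤ n → n ≤ N → ∀ v ∈ M.feSpace k n, ∀ K ∈ M.ref.cells,
    Metric.diam (M.cell n K) ^ 2 * ∫ x in M.cell n K, Laplacian.laplacian v x ^ 2 ≤
      cinv ^ 2 * ∫ x in M.cell n K, ‖gradient v x‖ ^ 2

end ALEMotion

/-- The data of the fully discrete scheme: the motion of the mesh, the polynomial degree `k`, the
time step, the diffusivity, the convective velocity `b(t,x)`, the reaction `c(t,x)`, the source
`f(t,x)`, and the stabilization parameters `δ_K` at the time levels (`K` is the reference cell). -/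
structure SchemeData (d N : ℕ) where
  motion : ALEMotion d N
  k : ℕ
  Δt : ℝ
  ε : ℝ
  b : ℝ → Space d → Space d
  c : ℝ → Space d → ℝ
  f : ℝ → Space d → ℝ
  δ : ℕ → Finset (Space d) → ℝ

namespace SchemeData

variable {d N : ℕ} (P : SchemeData d N)

/-- The time level `t^n = n Δt`. -/
def time (n : ℕ) : ℝ := n * P.Δt

/-- The streamline derivative `(b - w_h^n) · ∇v` at time `t^n`. -/
def streamline (n : ℕ) (v : Space d → ℝ) (x : Space d) : ℝ :=
  inner ℝ (P.b (P.time n) x - P.motion.velocity P.Δt n x) (gradient v x)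

/-- The bilinear form `a^n_SUPG`. -/
def aSUPG (n : ℕ) (u v : Space d → ℝ) : ℝ :=
  P.ε * (∫ x in P.motion.domain n, inner ℝ (gradient u x) (gradient v x)) +
  (∫ x in P.motion.domain n, inner ℝ (P.b (P.time n) x) (gradient u x) * v x) +
  (∫ x in P.motion.domain n, P.c (P.time n) x * u x * v x) +
  ∑ K ∈ P.motion.ref.cells, P.δ n K * ∫ x in P.motion.cell n K,
    (-P.ε * Laplacian.laplacian u x + P.streamline n u x + P.c (P.time n) x * u x) *
      P.streamline n v x

/-- The spatial part of the scheme, including the mesh velocity term. -/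
def spatialForm (n : ℕ) (u v : Space d → ℝ) : ℝ :=
  P.aSUPG n u v -
    ∫ x in P.motion.domain n, inner ℝ (P.motion.velocity P.Δt n x) (gradient u x) * v x

/-- The right-hand side of the scheme. -/
def load (n : ℕ) (v : Space d → ℝ) : ℝ :=
  (∫ x in P.motion.domain n, P.f (P.time n) x * v x) +
  ∑ K ∈ P.motion.ref.cells, P.δ n K * ∫ x in P.motion.cell n K,
    P.f (P.time n) x * P.streamline n v x

/-- The square of the mesh dependent norm `|||u|||` at time `t^n`. -/
def tripleNormSq (μ : ℝ) (n : ℕ) (u : Space d → ℝ) : ℝ :=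
  P.ε * (∫ x in P.motion.domain n, ‖gradient u x‖ ^ 2) +
  (∑ K ∈ P.motion.ref.cells, P.δ n K * ∫ x in P.motion.cell n K, P.streamline n u x ^ 2) +
  μ * P.motion.normSq n u

/-- One implicit Euler step, from `t^n` to `t^{n+1}`. -/
def IsEulerStep (u : ℕ → Space d → ℝ) (n : ℕ) : Prop :=
  ∀ v ∈ P.motion.feSpace P.k (n + 1),
    (∫ x in P.motion.domain (n + 1),
      (u (n + 1) x - u n (P.motion.transfer (n + 1) n x)) / P.Δt * v x) +
      P.spatialForm (n + 1) (u (n + 1)) v = P.load (n + 1) v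

/-- One step of the second order backward difference formula (BDF-2), from `t^{n-1}` and `t^n`
to `t^{n+1}`, for `n ≥ 1`. -/
def IsBDF2Step (u : ℕ → Space d → ℝ) (n : ℕ) : Prop :=
  ∀ v ∈ P.motion.feSpace P.k (n + 1),
    (∫ x in P.motion.domain (n + 1),
      (3 / 2 * u (n + 1) x - 2 * u n (P.motion.transfer (n + 1) n x) +
        1 / 2 * u (n - 1) (P.motion.transfer (n + 1) (n - 1) x)) / P.Δt * v x) +
      P.spatialForm (n + 1) (u (n + 1)) v = P.load (n + 1) v

/-- `2 α₁^n + α₂^n`. -/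
def growth (n : ℕ) : ℝ := 2 * P.motion.alpha₁ P.Δt n + P.motion.alpha₂ P.Δt n

/-- The factor `exp(Δt ∑_{i=1}^{n} (2α₁^i + α₂^i) / (1 - Δt (2α₁^i + α₂^i)))`. -/
def growthFactor (n : ℕ) : ℝ :=
  Real.exp (P.Δt * ∑ i ∈ Finset.Icc 1 n, P.growth i / (1 - P.Δt * P.growth i))

/-- `‖2u^{n+1} - u^n‖²` in `L²(Ω_{t^{n+1}})`. -/
def extrapolationSq (u : ℕ → Space d → ℝ) (n : ℕ) : ℝ :=
  P.motion.normSq (n + 1) fun x =>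
    2 * u (n + 1) x - u n (P.motion.transfer (n + 1) n x)

end SchemeData

end ALESUPG

end

noncomputable section

namespace ALESUPG

open Filter Topology
open scoped NNReal

/-! ### Affine maps and simplices -/

section Simplex

variable {d : ℕ}

/-! Testing each step with its own solution gives an energy inequality, built from a spatial and a
temporal estimate and closed by a discrete Gronwall argument.

Space. Integration by parts gives (b·∇u,u) + (cu,u) ≥ μ‖u‖² (`convection_reaction_feSpace`), and the
mesh velocity costs at most ½α₁‖u‖² (`mesh_velocity_term_le`). Young's inequality leaves half of the
streamline term in the stabilization; the inverse inequality and the bounds on δ_K absorb the rest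
into half of the diffusion and half of the reaction (`stabilization_ge`). Thus the spatial form is
at least ½|||u|||² − ½α₁‖u‖², and the load consumes only ¼|||u|||².

Time. The identity 4a(3/2 a − 2b + 1/2 c) = a² + (2a−b)² − b² − (2b−c)² + (a−2b+c)² telescopes,
except that the old quantities are measured on the new domain. On a cell the Jacobian J between two
levels is constant. Since the logarithmic derivative of a determinant is a trace, log|J| equals Δt
times the divergence of the mesh velocity at some intermediate time; with 1 − 1/|J| ≤ log|J| this
yields |J| ≤ 1 + Δt α₂ (`normSq_transfer_le`). The new level thus contributes α₁ implicitly and the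
old one α₂ explicitly, which `discrete_gronwall` handles.

Integration by parts is delicate because b is only locally Lipschitz: it need not extend to the
boundary, nor have integrable divergence. The finite element function is extended by zero to a
globally Lipschitz function, and u² is replaced by the squared distance of u from [-s,s], which has
compact support inside the domain. There b can be replaced by a globally Lipschitz field; then s →
0. -/

theorem hasFDerivAt_affineMap (g : Space d →ᵃ[ℝ] Space d) (x : Space d) :
    HasFDerivAt g (LinearMap.toContinuousLinearMap g.linear) x := by
  have h : (g : Space d → Space d) =
      fun x => LinearMap.toContinuousLinearMap g.linear x + g 0 := by
    funext y
    have := congrFun g.decomp y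
    simpa using this
  rw [h]
  exact (LinearMap.toContinuousLinearMap g.linear).hasFDerivAt.add_const _

theorem continuous_affineMap (g : Space d →ᵃ[ℝ] Space d) : Continuous g :=
  g.continuous_of_finiteDimensional

theorem image_interior_affineEquiv (e : Space d ≃ᵃ[ℝ] Space d) (s : Set (Space d)) :
    e '' interior s = interior (e '' s) :=
  (AffineEquiv.toContinuousAffineEquiv e).toHomeomorph.image_interior s

variable {T : Triangulation d} {K L : Finset (Space d)}

theorem Triangulation.interior_nonempty (hK : K ∈ T.cells) :
    (interior (convexHull ℝ (K : Set (Space d)))).Nonempty := by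
  rw [interior_convexHull_nonempty_iff_affineSpan_eq_top]
  have h := (T.affineIndependent K hK).affineSpan_eq_top_iff_card_eq_finrank_add_one.2
    (by simpa using T.card_eq K hK)
  simpa using h

theorem isCompact_simplex (K : Finset (Space d)) :
    IsCompact (convexHull ℝ (K : Set (Space d))) :=
  K.finite_toSet.isCompact_convexHull ℝ

theorem Triangulation.simplex_subset_region (hK : K ∈ T.cells) :
    convexHull ℝ (K : Set (Space d)) ⊆ T.region :=
  subset_biUnion_of_mem (u := fun K : Finset (Space d) => convexHull ℝ (K : Set (Space d))) hK

/-- Distinct simplices share fewer than d + 1 vertices, so the hull of the common ones lies in a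
proper affine subspace. -/
theorem Triangulation.volume_inter_eq_zero (hK : K ∈ T.cells) (hL : L ∈ T.cells) (hKL : K ≠ L) :
    volume (convexHull ℝ (K : Set (Space d)) ∩ convexHull ℝ (L : Set (Space d))) = 0 := by
  classical
  rw [T.inter_eq K hK L hL, ← Finset.coe_inter]
  have hss : K ∩ L ⊂ K := by
    refine Finset.ssubset_iff_subset_ne.2 ⟨Finset.inter_subset_left, fun h => hKL ?_⟩
    exact Finset.eq_of_subset_of_card_le (Finset.inter_eq_left.1 h)
      (by rw [T.card_eq K hK, T.card_eq L hL])
  have hind : AffineIndependent ℝ (fun p : (K ∩ L : Finset (Space d)) => (p : Space d)) :=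
    (T.affineIndependent K hK).mono (s := ((K ∩ L : Finset (Space d)) : Set (Space d)))
      (t := (K : Set (Space d))) (by exact_mod_cast hss.1)
  have hne : affineSpan ℝ ((K ∩ L : Finset (Space d)) : Set (Space d)) ≠ ⊤ := by
    intro h
    have h2 := hind.affineSpan_eq_top_iff_card_eq_finrank_add_one.1
      (by rwa [Subtype.range_coe_subtype, Finset.setOfPred_mem])
    have h3 := Finset.card_lt_card hss
    rw [T.card_eq K hK] at h3
    simp only [Fintype.card_coe, finrank_euclideanSpace, Fintype.card_fin] at h2
    omega
  exact measure_mono_null (convexHull_subset_affineSpan _) (Measure.addHaar_affineSubspace _ _ hne)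

end Simplex

/-! ### Deformations of a triangulation -/

/-- `φ` is affine on every cell of the triangulation and injective on the region it covers. -/
structure Triangulation.IsDeformation {d : ℕ} (T : Triangulation d) (φ : Space d → Space d) :
    Prop where
  affine : ∀ K ∈ T.cells, ∃ g : Space d →ᵃ[ℝ] Space d,
    EqOn φ g (convexHull ℝ (K : Set (Space d)))
  injOn : InjOn φ T.region

/-- The image of a closed simplex. -/
def imageCell {d : ℕ} (φ : Space d → Space d) (K : Finset (Space d)) : Set (Space d) :=
  φ '' convexHull ℝ (K : Set (Space d))

namespace Triangulation

variable {d : ℕ} (T : Triangulation d)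

/-- The image of the interior of the region. -/
def imageDomain (φ : Space d → Space d) : Set (Space d) := φ '' interior T.region

/-- The inverse on the region covered by the triangulation. -/
def inverse (φ : Space d → Space d) : Space d → Space d := Function.invFunOn φ T.region

end Triangulation

namespace Triangulation.IsDeformation

variable {d : ℕ} {T : Triangulation d} {φ ψ : Space d → Space d} {K L : Finset (Space d)}

/-- If the linear part annihilated a direction v, two points of the simplex differing by a small
multiple of v would have the same image, against injectivity. -/
theorem bijective_of_eqOn (h : T.IsDeformation φ) (hK : K ∈ T.cells) {g : Space d →ᵃ[ℝ] Space d}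
    (hg : EqOn φ g (convexHull ℝ (K : Set (Space d)))) : Function.Bijective g := by
  have hinj : Function.Injective g.linear := by
    rw [injective_iff_map_eq_zero]
    intro v hv
    obtain ⟨x, hx⟩ := T.interior_nonempty hK
    by_contra hv0
    have hcont : Tendsto (fun t : ℝ => x + t • v) (𝓝 0) (𝓝 x) := by
      have : Continuous (fun t : ℝ => x + t • v) := by fun_prop
      simpa using this.tendsto 0
    have hev : ∀ᶠ t : ℝ in 𝓝 0, x + t • v ∈ convexHull ℝ (K : Set (Space d)) :=
      hcont.eventually (mem_interior_iff_mem_nhds.1 hx)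
    obtain ⟨t, ht, ht0⟩ := (hev.filter_mono nhdsWithin_le_nhds |>.and
      (self_mem_nhdsWithin (s := {0}ᶜ) (a := (0 : ℝ)))).exists
    have hgx : g (x + t • v) = g x := by
      rw [add_comm, ← vadd_eq_add, g.map_vadd]
      simp [hv]
    have := h.injOn (simplex_subset_region hK ht)
      (simplex_subset_region hK (interior_subset hx))
      (by rw [hg ht, hg (interior_subset hx), hgx])
    have h2 : t • v = 0 := by simpa using this
    rcases smul_eq_zero.1 h2 with h3 | h3
    · exact ht0 h3
    · exact hv0 h3
  exact g.linear_bijective_iff.1 ⟨hinj, LinearMap.injective_iff_surjective.1 hinj⟩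

theorem exists_affineEquiv (h : T.IsDeformation φ) (hK : K ∈ T.cells) :
    ∃ e : Space d ≃ᵃ[ℝ] Space d, EqOn φ e (convexHull ℝ (K : Set (Space d))) := by
  obtain ⟨g, hg⟩ := h.affine K hK
  exact ⟨AffineEquiv.ofBijective (h.bijective_of_eqOn hK hg), fun x hx => by simpa using hg hx⟩

theorem imageCell_eq {e : Space d ≃ᵃ[ℝ] Space d}
    (he : EqOn φ e (convexHull ℝ (K : Set (Space d)))) :
    imageCell φ K = e '' convexHull ℝ (K : Set (Space d)) := he.image_eq

theorem interior_imageCell (h : T.IsDeformation φ) (hK : K ∈ T.cells) :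
    interior (imageCell φ K) = φ '' interior (convexHull ℝ (K : Set (Space d))) := by
  obtain ⟨e, he⟩ := h.exists_affineEquiv hK
  rw [imageCell_eq he, ← image_interior_affineEquiv, (he.mono interior_subset).image_eq]

theorem isCompact_imageCell (h : T.IsDeformation φ) (hK : K ∈ T.cells) :
    IsCompact (imageCell φ K) := by
  obtain ⟨e, he⟩ := h.exists_affineEquiv hK
  rw [imageCell_eq he]
  exact (isCompact_simplex K).image (continuous_affineMap e.toAffineMap)

theorem convex_imageCell (h : T.IsDeformation φ) (hK : K ∈ T.cells) :
    Convex ℝ (imageCell φ K) := by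
  obtain ⟨e, he⟩ := h.exists_affineEquiv hK
  rw [imageCell_eq he]
  exact (convex_convexHull ℝ _).affine_image e.toAffineMap

theorem interior_imageCell_nonempty (h : T.IsDeformation φ) (hK : K ∈ T.cells) :
    (interior (imageCell φ K)).Nonempty := by
  rw [h.interior_imageCell hK]
  exact (T.interior_nonempty hK).image _

theorem measurableSet_imageCell (h : T.IsDeformation φ) (hK : K ∈ T.cells) :
    MeasurableSet (imageCell φ K) := (h.isCompact_imageCell hK).measurableSet

theorem interior_ae_eq_imageCell (h : T.IsDeformation φ) (hK : K ∈ T.cells) :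
    interior (imageCell φ K) =ᵐ[volume] imageCell φ K :=
  interior_ae_eq_of_null_frontier ((h.convex_imageCell hK).addHaar_frontier volume)

theorem ae_mem_interior_imageCell (h : T.IsDeformation φ) (hK : K ∈ T.cells) :
    ∀ᵐ x ∂(volume.restrict (imageCell φ K)), x ∈ interior (imageCell φ K) := by
  rw [← Measure.restrict_congr_set (h.interior_ae_eq_imageCell hK)]
  exact ae_restrict_mem isOpen_interior.measurableSet

theorem interior_imageCell_subset_imageDomain (h : T.IsDeformation φ) (hK : K ∈ T.cells) :
    interior (imageCell φ K) ⊆ T.imageDomain φ := by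
  rw [h.interior_imageCell hK]
  exact image_mono (interior_mono (simplex_subset_region hK))

theorem interior_imageCell_subset (h : T.IsDeformation φ) (hK : K ∈ T.cells) :
    interior (imageCell φ K) ⊆ interior (T.imageDomain φ) :=
  interior_maximal (h.interior_imageCell_subset_imageDomain hK) isOpen_interior

theorem image_region (T : Triangulation d) (φ : Space d → Space d) :
    φ '' T.region = ⋃ K : T.cells, imageCell φ K := by
  simp only [Triangulation.region, image_iUnion₂, imageCell]
  exact (iUnion_subtype (fun K => K ∈ T.cells)
    (fun K => φ '' convexHull ℝ (K.1 : Set (Space d)))).symm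

theorem imageDomain_subset (T : Triangulation d) (φ : Space d → Space d) :
    T.imageDomain φ ⊆ ⋃ K : T.cells, imageCell φ K := by
  rw [← image_region]
  exact image_mono interior_subset

theorem iUnion_interior_ae_eq (h : T.IsDeformation φ) :
    (⋃ K : T.cells, interior (imageCell φ K)) =ᵐ[volume] ⋃ K : T.cells, imageCell φ K :=
  Filter.EventuallyEq.countable_iUnion fun K => h.interior_ae_eq_imageCell K.2

/-- The image of the interior lies between the union of the open image cells and that of the closed
ones, which differ by null frontiers of convex sets. -/
theorem imageDomain_ae_eq (h : T.IsDeformation φ) :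
    T.imageDomain φ =ᵐ[volume] ⋃ K : T.cells, imageCell φ K := by
  refine (imageDomain_subset T φ).eventuallyLE.antisymm ?_
  refine h.iUnion_interior_ae_eq.symm.le.trans (LE.le.eventuallyLE ?_)
  exact iUnion_subset fun K => h.interior_imageCell_subset_imageDomain K.2

/-- Thanks to this, the image need not be known to be open: analysis that requires an open set is
done on its interior, at no cost for integrals. -/
theorem interior_imageDomain_ae_eq (h : T.IsDeformation φ) :
    interior (T.imageDomain φ) =ᵐ[volume] T.imageDomain φ := by
  refine interior_subset.eventuallyLE.antisymm ?_
  refine h.imageDomain_ae_eq.le.trans (h.iUnion_interior_ae_eq.symm.le.trans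
    (LE.le.eventuallyLE ?_))
  exact iUnion_subset fun K => h.interior_imageCell_subset K.2

theorem continuousOn_simplex (h : T.IsDeformation φ) (hK : K ∈ T.cells) :
    ContinuousOn φ (convexHull ℝ (K : Set (Space d))) := by
  obtain ⟨e, he⟩ := h.exists_affineEquiv hK
  exact (continuous_affineMap e.toAffineMap).continuousOn.congr he

theorem closure_imageDomain (h : T.IsDeformation φ) :
    closure (T.imageDomain φ) = ⋃ K : T.cells, imageCell φ K := by
  refine Subset.antisymm (closure_minimal (imageDomain_subset T φ)
    (isClosed_iUnion_of_finite fun K => (h.isCompact_imageCell K.2).isClosed))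
    (iUnion_subset fun K => ?_)
  have h1 : closure (interior (imageCell φ K)) = imageCell φ K := by
    rw [(h.convex_imageCell K.2).closure_interior_eq_closure_of_nonempty_interior
      (h.interior_imageCell_nonempty K.2), (h.isCompact_imageCell K.2).isClosed.closure_eq]
  rw [← h1]
  exact closure_mono (h.interior_imageCell_subset_imageDomain K.2)

theorem isCompact_closure_imageDomain (h : T.IsDeformation φ) :
    IsCompact (closure (T.imageDomain φ)) := by
  rw [h.closure_imageDomain]
  exact isCompact_iUnion fun K => h.isCompact_imageCell K.2

theorem imageCell_subset_closure (h : T.IsDeformation φ) (hK : K ∈ T.cells) :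
    imageCell φ K ⊆ closure (T.imageDomain φ) := by
  rw [h.closure_imageDomain]
  exact subset_iUnion (fun K : T.cells => imageCell φ K) ⟨K, hK⟩

/-- Injectivity on the region turns the intersection of the images into the image of a null
intersection, under a map that is affine there. -/
theorem aedisjoint_imageCell (h : T.IsDeformation φ) (hK : K ∈ T.cells) (hL : L ∈ T.cells)
    (hKL : K ≠ L) : AEDisjoint volume (imageCell φ K) (imageCell φ L) := by
  obtain ⟨e, he⟩ := h.exists_affineEquiv hK
  unfold AEDisjoint imageCell
  rw [← h.injOn.image_inter (simplex_subset_region hK) (simplex_subset_region hL),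
    (he.mono inter_subset_left).image_eq]
  exact addHaar_image_eq_zero_of_differentiableOn_of_addHaar_eq_zero volume
    (fun x _ => (hasFDerivAt_affineMap e.toAffineMap x).differentiableAt.differentiableWithinAt)
    (T.volume_inter_eq_zero hK hL hKL)

theorem restrict_imageDomain (h : T.IsDeformation φ) :
    volume.restrict (T.imageDomain φ) =
      ∑ K ∈ T.cells, volume.restrict (imageCell φ K) := by
  rw [Measure.restrict_congr_set h.imageDomain_ae_eq, Measure.restrict_iUnion_ae
    (fun K L hKL => h.aedisjoint_imageCell K.2 L.2 (fun hh => hKL (Subtype.ext hh)))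
    (fun K => (h.measurableSet_imageCell K.2).nullMeasurableSet), Measure.sum_fintype]
  exact Finset.sum_coe_sort T.cells (fun K => volume.restrict (imageCell φ K))

theorem restrict_imageCell_le (h : T.IsDeformation φ) (hK : K ∈ T.cells) :
    volume.restrict (imageCell φ K) ≤ volume.restrict (T.imageDomain φ) := by
  rw [h.restrict_imageDomain]
  exact Finset.single_le_sum (f := fun K => volume.restrict (imageCell φ K))
    (fun _ _ => Measure.zero_le _) hK

theorem integral_imageDomain (h : T.IsDeformation φ) {f : Space d → ℝ}
    (hf : Integrable f (volume.restrict (T.imageDomain φ))) :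
    ∫ x in T.imageDomain φ, f x = ∑ K ∈ T.cells, ∫ x in imageCell φ K, f x := by
  rw [h.restrict_imageDomain, integral_finsetSum_measure]
  exact fun K hK => hf.mono_measure (h.restrict_imageCell_le hK)

theorem ae_imageDomain_iff (h : T.IsDeformation φ) {p : Space d → Prop} :
    (∀ᵐ x ∂(volume.restrict (T.imageDomain φ)), p x) ↔
      ∀ K ∈ T.cells, ∀ᵐ x ∂(volume.restrict (imageCell φ K)), p x := by
  rw [Measure.restrict_congr_set h.imageDomain_ae_eq, ae_restrict_iUnion_iff]
  exact ⟨fun H K hK => H ⟨K, hK⟩, fun H K => H K K.2⟩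

theorem isFiniteMeasure_imageDomain (h : T.IsDeformation φ) :
    IsFiniteMeasure (volume.restrict (T.imageDomain φ)) :=
  ⟨by
    rw [Measure.restrict_apply_univ]
    exact (measure_mono subset_closure).trans_lt h.isCompact_closure_imageDomain.measure_lt_top⟩

/-! ### Inverse and transfer -/

theorem inverse_apply (h : T.IsDeformation φ) {Y : Space d} (hY : Y ∈ T.region) :
    T.inverse φ (φ Y) = Y :=
  h.injOn.leftInvOn_invFunOn hY

theorem inverse_eqOn (h : T.IsDeformation φ) (hK : K ∈ T.cells) {e : Space d ≃ᵃ[ℝ] Space d}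
    (he : EqOn φ e (convexHull ℝ (K : Set (Space d)))) :
    EqOn (T.inverse φ) e.symm (imageCell φ K) := by
  rintro _ ⟨Y, hY, rfl⟩
  rw [h.inverse_apply (simplex_subset_region hK hY), he hY, e.symm_apply_apply]

theorem inverse_mem (h : T.IsDeformation φ) (hK : K ∈ T.cells) {x : Space d}
    (hx : x ∈ imageCell φ K) : T.inverse φ x ∈ convexHull ℝ (K : Set (Space d)) := by
  obtain ⟨Y, hY, rfl⟩ := hx
  rwa [h.inverse_apply (simplex_subset_region hK hY)]

theorem continuousOn_inverse (h : T.IsDeformation φ) (hK : K ∈ T.cells) :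
    ContinuousOn (T.inverse φ) (imageCell φ K) := by
  obtain ⟨e, he⟩ := h.exists_affineEquiv hK
  exact (continuous_affineMap e.symm.toAffineMap).continuousOn.congr (h.inverse_eqOn hK he)

/-- Change of variables on one cell, where the transfer map is affine and its determinant leaves the
integral. -/
theorem integral_transfer (h : T.IsDeformation φ) (h' : T.IsDeformation ψ) (hK : K ∈ T.cells)
    {e e' : Space d ≃ᵃ[ℝ] Space d}
    (he : EqOn φ e (convexHull ℝ (K : Set (Space d))))
    (he' : EqOn ψ e' (convexHull ℝ (K : Set (Space d)))) (F : Space d → ℝ) :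
    ∫ x in imageCell ψ K, F (φ (T.inverse ψ x)) =
      |LinearMap.det ((e.symm.trans e').linear : Space d →ₗ[ℝ] Space d)| *
        ∫ x in imageCell φ K, F x := by
  have himg : imageCell ψ K = (e.symm.trans e') '' imageCell φ K := by
    rw [imageCell_eq he, imageCell_eq he', image_image]
    simp
  have key := integral_image_eq_integral_abs_det_fderiv_smul volume
    (s := imageCell φ K) (f := e.symm.trans e') (h.measurableSet_imageCell hK)
    (fun x _ => (hasFDerivAt_affineMap (e.symm.trans e').toAffineMap x).hasFDerivWithinAt)
    (e.symm.trans e').injective.injOn (fun x => F (φ (T.inverse ψ x)))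
  rw [← himg] at key
  rw [key, ← integral_const_mul]
  refine setIntegral_congr_fun (h.measurableSet_imageCell hK) fun x hx => ?_
  obtain ⟨Y, hY, rfl⟩ := hx
  have h1 : (e.symm.trans e') (φ Y) = ψ Y := by rw [he hY, he' hY]; simp
  simp only [smul_eq_mul]
  rw [h1, h'.inverse_apply (simplex_subset_region hK hY)]
  rfl

/-! ### Functions that are continuous on every cell -/

/-- `v` is continuous on every closed cell of the deformed triangulation. -/
def _root_.ALESUPG.Triangulation.ContinuousOnCells {E : Type*} [TopologicalSpace E]
    (T : Triangulation d) (φ : Space d → Space d) (v : Space d → E) : Prop :=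
  ∀ K ∈ T.cells, ContinuousOn v (imageCell φ K)

variable {E : Type*} [NormedAddCommGroup E]

theorem exists_bound (h : T.IsDeformation φ) {v : Space d → E} (hv : T.ContinuousOnCells φ v) :
    ∃ C, ∀ x ∈ closure (T.imageDomain φ), ‖v x‖ ≤ C := by
  have : ∀ K : T.cells, ∃ C, ∀ x ∈ imageCell φ K, ‖v x‖ ≤ C := fun K =>
    (h.isCompact_imageCell K.2).exists_bound_of_continuousOn (hv K K.2)
  choose C hC using this
  refine ⟨∑ K, |C K|, fun x hx => ?_⟩
  rw [h.closure_imageDomain] at hx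
  obtain ⟨K, hK⟩ := mem_iUnion.1 hx
  exact (hC K x hK).trans ((le_abs_self _).trans
    (Finset.single_le_sum (f := fun K => |C K|) (fun _ _ => abs_nonneg _) (Finset.mem_univ K)))

theorem aestronglyMeasurable (h : T.IsDeformation φ) {v : Space d → E}
    [SecondCountableTopology E]
    (hv : ∀ K ∈ T.cells, AEStronglyMeasurable v (volume.restrict (imageCell φ K))) :
    AEStronglyMeasurable v (volume.restrict (T.imageDomain φ)) := by
  rw [Measure.restrict_congr_set h.imageDomain_ae_eq]
  exact AEStronglyMeasurable.iUnion fun K => hv K K.2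

theorem memLp_top_of_bound (h : T.IsDeformation φ) {v : Space d → E} {C : ℝ}
    (hm : AEStronglyMeasurable v (volume.restrict (T.imageDomain φ)))
    (hC : ∀ᵐ x ∂(volume.restrict (T.imageDomain φ)), ‖v x‖ ≤ C) (p : ℝ≥0∞) :
    MemLp v p (volume.restrict (T.imageDomain φ)) :=
  haveI := h.isFiniteMeasure_imageDomain
  MemLp.of_bound hm C hC

theorem memLp (h : T.IsDeformation φ) {v : Space d → E} [SecondCountableTopology E]
    (hv : T.ContinuousOnCells φ v) (p : ℝ≥0∞) :
    MemLp v p (volume.restrict (T.imageDomain φ)) := by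
  obtain ⟨C, hC⟩ := h.exists_bound hv
  refine h.memLp_top_of_bound (C := C) (h.aestronglyMeasurable fun K hK =>
    (hv K hK).aestronglyMeasurable (h.measurableSet_imageCell hK)) ?_ p
  rw [h.ae_imageDomain_iff]
  exact fun K hK => (ae_restrict_iff' (h.measurableSet_imageCell hK)).2
    (.of_forall fun x hx => hC x (h.imageCell_subset_closure hK hx))

theorem continuousOnCells_transfer (h : T.IsDeformation φ) (h' : T.IsDeformation ψ)
    {v : Space d → E} (hv : T.ContinuousOnCells φ v) :
    T.ContinuousOnCells ψ (fun x => v (φ (T.inverse ψ x))) := by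
  intro K hK
  refine (hv K hK).comp ((h.continuousOn_simplex hK).comp (h'.continuousOn_inverse hK)
    fun x hx => h'.inverse_mem hK hx) fun x hx => ?_
  exact mem_image_of_mem _ (h'.inverse_mem hK hx)

end Triangulation.IsDeformation

/-! ### The logarithmic derivative of a determinant along a segment of matrices -/

section Det

variable {m : Type*} [Fintype m] [DecidableEq m]

/-- With L the matrix at θ and N = L⁻¹(B − A), the matrix at t is L(1 + (t − θ)N), and det(1 + rN) =
1 + r tr N + O(r²) with a polynomial remainder. -/
theorem hasDerivAt_det_segment (A B : Matrix m m ℝ) {θ : ℝ}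
    (h : (θ • B + (1 - θ) • A).det ≠ 0) :
    HasDerivAt (fun t : ℝ => (t • B + (1 - t) • A).det)
      ((θ • B + (1 - θ) • A).det * ((B - A) * (θ • B + (1 - θ) • A)⁻¹).trace) θ := by
  set L := θ • B + (1 - θ) • A with hL
  have hu : IsUnit L.det := isUnit_iff_ne_zero.2 h
  set N : Matrix m m ℝ := L⁻¹ * (B - A) with hN
  have hLN : L * N = B - A := by rw [hN, ← mul_assoc, Matrix.mul_nonsing_inv _ hu, one_mul]
  obtain ⟨q, hq⟩ : ∃ q : Polynomial ℝ, ∀ r : ℝ,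
      (1 + r • N).det = 1 + N.trace * r + q.eval r * r ^ 2 :=
    ⟨_, fun r => Matrix.det_one_add_smul r N⟩
  have hfun : (fun t : ℝ => (t • B + (1 - t) • A).det) = fun t : ℝ =>
      L.det * (1 + N.trace * (t - θ) + q.eval (t - θ) * (t - θ) ^ 2) := by
    funext t
    rw [← hq, ← Matrix.det_mul, mul_add, mul_one, Matrix.mul_smul, hLN, hL]
    congr 1
    module
  have htr : ((B - A) * L⁻¹).trace = N.trace := Matrix.trace_mul_comm _ _
  rw [hfun, htr]
  have h1 : HasDerivAt (fun t : ℝ => t - θ) 1 θ := (hasDerivAt_id θ).sub_const θ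
  have h2 : HasDerivAt (fun t : ℝ => q.eval (t - θ)) (q.derivative.eval (θ - θ)) θ :=
    (q.hasDerivAt (θ - θ)).comp_sub_const θ θ
  have h3 := (((h1.const_mul N.trace).const_add 1).add (h2.mul (h1.pow 2))).const_mul L.det
  refine HasDerivAt.congr_deriv (f := fun t : ℝ =>
    L.det * (1 + N.trace * (t - θ) + q.eval (t - θ) * (t - θ) ^ 2)) h3 ?_
  simp

/-- Mean value theorem for the logarithm of the determinant. `Real.log` is log|·|, so nonvanishing
suffices and the sign of the determinants plays no role. -/
theorem exists_log_det_eq_trace (A B : Matrix m m ℝ)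
    (h : ∀ θ ∈ Icc (0 : ℝ) 1, (θ • B + (1 - θ) • A).det ≠ 0) :
    ∃ θ ∈ Ioo (0 : ℝ) 1, Real.log B.det - Real.log A.det =
      ((B - A) * (θ • B + (1 - θ) • A)⁻¹).trace := by
  have hd : ∀ θ ∈ Icc (0 : ℝ) 1, HasDerivAt (fun t : ℝ => Real.log (t • B + (1 - t) • A).det)
      (((B - A) * (θ • B + (1 - θ) • A)⁻¹).trace) θ := by
    intro θ hθ
    refine ((hasDerivAt_det_segment A B (h θ hθ)).log (h θ hθ)).congr_deriv ?_
    rw [mul_div_assoc, mul_div_cancel₀ _ (h θ hθ)]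
  obtain ⟨θ, hθ, heq⟩ := exists_hasDerivAt_eq_slope
    (fun t : ℝ => Real.log (t • B + (1 - t) • A).det)
    (fun θ => ((B - A) * (θ • B + (1 - θ) • A)⁻¹).trace) zero_lt_one
    (fun θ hθ => (hd θ hθ).continuousAt.continuousWithinAt)
    (fun θ hθ => hd θ (Ioo_subset_Icc_self hθ))
  exact ⟨θ, hθ, by simpa using heq.symm⟩

theorem exists_bound_trace_segment (A B : Matrix m m ℝ)
    (h : ∀ θ ∈ Icc (0 : ℝ) 1, (θ • B + (1 - θ) • A).det ≠ 0) :
    ∃ C, ∀ θ ∈ Icc (0 : ℝ) 1, |((B - A) * (θ • B + (1 - θ) • A)⁻¹).trace| ≤ C := by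
  have hc : Continuous fun θ : ℝ => θ • B + (1 - θ) • A := by fun_prop
  refine isCompact_Icc.exists_bound_of_continuousOn
    (f := fun θ : ℝ => ((B - A) * (θ • B + (1 - θ) • A)⁻¹).trace) ?_
  -- Writing the inverse as the adjugate over the determinant makes continuity in θ evident.
  have : ContinuousOn (fun θ : ℝ => ((θ • B + (1 - θ) • A).det)⁻¹ *
      ((B - A) * (θ • B + (1 - θ) • A).adjugate).trace) (Icc 0 1) :=
    (hc.matrix_det.continuousOn.inv₀ h).mul
      (continuous_const.matrix_mul hc.matrix_adjugate).matrix_trace.continuousOn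
  refine this.congr fun θ _ => ?_
  simp [Matrix.inv_def, Ring.inverse_eq_inv']

end Det

/-! ### Divergence -/

theorem divergence_eq_trace {d : ℕ} {F : Space d → Space d} {x : Space d}
    {G : Space d →L[ℝ] Space d} (h : HasFDerivAt F G x) :
    divergence F x = LinearMap.trace ℝ (Space d) G := by
  rw [divergence, h.fderiv,
    LinearMap.trace_eq_matrix_trace ℝ (EuclideanSpace.basisFun (Fin d) ℝ).toBasis, Matrix.trace]
  refine Finset.sum_congr rfl fun i _ => ?_
  simp [LinearMap.toMatrix_apply]

/-! ### Mesh motion: Jacobians, the constants α₁ and α₂, and transfer of L² norms -/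

namespace ALEMotion

variable {d N : ℕ} (M : ALEMotion d N)

theorem interp_zero (n : ℕ) : M.interp n 0 = M.map n := by
  funext Y; simp [interp]

theorem interp_one (n : ℕ) : M.interp n 1 = M.map (n + 1) := by
  funext Y; simp [interp]

theorem interp_eqOn {n : ℕ} {K : Finset (Space d)} {g₀ g₁ : Space d →ᵃ[ℝ] Space d}
    (h₀ : EqOn (M.map n) g₀ (convexHull ℝ (K : Set (Space d))))
    (h₁ : EqOn (M.map (n + 1)) g₁ (convexHull ℝ (K : Set (Space d)))) (θ : ℝ) :
    EqOn (M.interp n θ) (θ • g₁ + (1 - θ) • g₀ : Space d →ᵃ[ℝ] Space d)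
      (convexHull ℝ (K : Set (Space d))) := by
  intro Y hY
  simp [interp, h₀ hY, h₁ hY]

theorem isDeformation_interp {n : ℕ} (hn : n < N) {θ : ℝ} (hθ : θ ∈ Icc (0 : ℝ) 1) :
    M.ref.IsDeformation (M.interp n θ) where
  affine K hK := by
    obtain ⟨g₀, h₀⟩ := M.piecewiseAffine n hn.le K hK
    obtain ⟨g₁, h₁⟩ := M.piecewiseAffine (n + 1) hn K hK
    exact ⟨_, M.interp_eqOn h₀ h₁ θ⟩
  injOn := M.injOn n hn θ hθ

/-- Injectivity is assumed only for the interpolants, so it is read off at θ = 0 or θ = 1; this is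
where 0 < N is needed. -/
theorem isDeformation_map {n : ℕ} (hn : n ≤ N) (hN : 0 < N) : M.ref.IsDeformation (M.map n) := by
  rcases n with _ | m
  · rw [← M.interp_zero]
    exact M.isDeformation_interp hN ⟨le_rfl, zero_le_one⟩
  · rw [← M.interp_one]
    exact M.isDeformation_interp (Nat.lt_of_succ_le hn) ⟨zero_le_one, le_rfl⟩

/-- On a cell the divergence of the mesh velocity and the Jacobian are constant in space, and the
logarithm of the Jacobian is a value of the divergence. -/
theorem exists_jacobian_divergence {n : ℕ} (hn : n < N) {Δt : ℝ} (hΔt : 0 < Δt)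
    {K : Finset (Space d)} (hK : K ∈ M.ref.cells) :
    ∃ (J : ℝ) (D : ℝ → ℝ), J ≠ 0 ∧
      (∀ θ ∈ Icc (0 : ℝ) 1, ∀ x ∈ interior (imageCell (M.interp n θ) K),
        divergence (M.stepVelocity Δt n θ) x = D θ ∧
        M.jacobian n (M.map n (M.interpInv n θ x)) = J) ∧
      (∃ C, ∀ θ ∈ Icc (0 : ℝ) 1, |D θ| ≤ C) ∧
      (∃ θ ∈ Ioo (0 : ℝ) 1, Real.log J = Δt * D θ) ∧
      (∀ F : Space d → ℝ, ∫ x in M.cell (n + 1) K, F (M.transfer (n + 1) n x) =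
        |J| * ∫ x in M.cell n K, F x) := by
  have hN : 0 < N := by omega
  have h₀ := M.isDeformation_map hn.le hN
  have h₁ := M.isDeformation_map (Nat.succ_le_of_lt hn) hN
  obtain ⟨e₀, he₀⟩ := h₀.exists_affineEquiv hK
  obtain ⟨e₁, he₁⟩ := h₁.exists_affineEquiv hK
  set b := (EuclideanSpace.basisFun (Fin d) ℝ).toBasis with hb
  set A := LinearMap.toMatrix b b e₀.linear with hA
  set B := LinearMap.toMatrix b b e₁.linear with hB
  -- On K every interpolant is an affine equivalence whose matrix lies on the segment from A to B;
  -- its determinant therefore never vanishes.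
  have hθ : ∀ θ ∈ Icc (0 : ℝ) 1, ∃ e : Space d ≃ᵃ[ℝ] Space d,
      EqOn (M.interp n θ) e (convexHull ℝ (K : Set (Space d))) ∧
      LinearMap.toMatrix b b e.linear = θ • B + (1 - θ) • A := by
    intro θ hθ
    have hg := M.interp_eqOn (g₀ := e₀.toAffineMap) (g₁ := e₁.toAffineMap) he₀ he₁ θ
    refine ⟨AffineEquiv.ofBijective ((M.isDeformation_interp hn hθ).bijective_of_eqOn hK hg),
      fun x hx => by simpa using hg hx, ?_⟩
    rw [hA, hB, ← map_smul, ← map_smul, ← map_add]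
    rfl
  have hdet : ∀ e : Space d ≃ᵃ[ℝ] Space d, (LinearMap.toMatrix b b e.linear).det ≠ 0 := by
    intro e
    rw [LinearMap.det_toMatrix]
    exact (LinearEquiv.isUnit_det' e.linear).ne_zero
  have hne : ∀ θ ∈ Icc (0 : ℝ) 1, (θ • B + (1 - θ) • A).det ≠ 0 := by
    intro θ h
    obtain ⟨e, -, he⟩ := hθ θ h
    rw [← he]
    exact hdet e
  set J := LinearMap.det ((e₀.symm.trans e₁).linear : Space d →ₗ[ℝ] Space d) with hJ
  have hJ' : J * A.det = B.det := by
    rw [hJ, hA, hB, LinearMap.det_toMatrix, LinearMap.det_toMatrix, ← LinearMap.det_comp]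
    congr 1
    ext x : 1
    change e₁.linear (e₀.linear.symm (e₀.linear x)) = e₁.linear x
    rw [LinearEquiv.symm_apply_apply]
  have hJ0 : J ≠ 0 := by
    intro h
    rw [h, zero_mul] at hJ'
    exact hdet e₁ hJ'.symm
  refine ⟨J, fun θ => Δt⁻¹ * ((B - A) * (θ • B + (1 - θ) • A)⁻¹).trace, hJ0, ?_, ?_, ?_, ?_⟩
  · intro θ h x hx
    obtain ⟨e, he, heL⟩ := hθ θ h
    have hd := M.isDeformation_interp hn h
    constructor
    -- Near an interior point of the cell the mesh velocity is Δt⁻¹(e₁ − e₀) ∘ e⁻¹, so its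
    -- divergence is the trace of Δt⁻¹(B − A)(θB + (1 − θ)A)⁻¹.
    · have hev : M.stepVelocity Δt n θ =ᶠ[𝓝 x]
          ((Δt⁻¹ • (e₁.toAffineMap - e₀.toAffineMap)).comp e.symm.toAffineMap :
            Space d →ᵃ[ℝ] Space d) := by
        filter_upwards [mem_interior_iff_mem_nhds.1 hx] with y hy
        have hY := hd.inverse_mem hK hy
        simp only [stepVelocity, interpInv]
        change Δt⁻¹ • (M.map (n + 1) (M.ref.inverse (M.interp n θ) y) -
          M.map n (M.ref.inverse (M.interp n θ) y)) = _
        rw [he₀ hY, he₁ hY, hd.inverse_eqOn hK he hy]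
        simp
      rw [divergence_eq_trace ((hasFDerivAt_affineMap _ x).congr_of_eventuallyEq hev),
        LinearMap.trace_eq_matrix_trace ℝ b]
      dsimp only
      rw [← smul_eq_mul, ← Matrix.trace_smul,
        ← Matrix.smul_mul]
      congr 1
      have hinv : (θ • B + (1 - θ) • A)⁻¹ = LinearMap.toMatrix b b e.symm.linear := by
        rw [← heL]
        refine Matrix.inv_eq_left_inv ?_
        rw [← LinearMap.toMatrix_comp]
        convert LinearMap.toMatrix_id b
        ext x : 1
        simp
      rw [hinv, hA, hB, ← map_sub, ← map_smul, ← LinearMap.toMatrix_comp]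
      rfl
    · have hY := hd.inverse_mem hK (interior_subset hx)
      rw [hd.interior_imageCell hK] at hx
      obtain ⟨Y, hYi, rfl⟩ := hx
      have hYK := interior_subset hYi
      have hYr := Triangulation.simplex_subset_region hK hYK
      have hinv : M.interpInv n θ (M.interp n θ Y) = Y := hd.inverse_apply hYr
      rw [hinv, jacobian]
      have hmem : M.map n Y ∈ interior (imageCell (M.map n) K) := by
        rw [h₀.interior_imageCell hK]; exact mem_image_of_mem _ hYi
      have hev : M.transfer n (n + 1) =ᶠ[𝓝 (M.map n Y)] (e₀.symm.trans e₁).toAffineMap := by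
        filter_upwards [mem_interior_iff_mem_nhds.1 hmem] with y hy
        change M.map (n + 1) (M.ref.inverse (M.map n) y) = _
        rw [he₁ (h₀.inverse_mem hK hy), h₀.inverse_eqOn hK he₀ hy]
        simp
      rw [((hasFDerivAt_affineMap _ _).congr_of_eventuallyEq hev).fderiv]
      rfl
  · obtain ⟨C, hC⟩ := exists_bound_trace_segment A B hne
    exact ⟨|Δt⁻¹| * C, fun θ h => by
      rw [abs_mul]; exact mul_le_mul_of_nonneg_left (hC θ h) (abs_nonneg _)⟩
  · obtain ⟨θ, h, heq⟩ := exists_log_det_eq_trace A B hne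
    refine ⟨θ, h, ?_⟩
    dsimp only
    rw [← heq, ← hJ', Real.log_mul hJ0 (hdet e₀)]
    field_simp
    ring
  · exact fun F => h₀.integral_transfer h₁ hK he₀ he₁ F

theorem abs_divergence_le_alpha₁ {n : ℕ} (hn : n < N) {Δt : ℝ} (hΔt : 0 < Δt) :
    ∀ᵐ x ∂(volume.restrict (M.domain (n + 1))),
      |divergence (M.velocity Δt (n + 1)) x| ≤ M.alpha₁ Δt (n + 1) := by
  have h := M.isDeformation_map (Nat.succ_le_of_lt hn) (by omega)
  have hb : ∃ C, ∀ᵐ x ∂(volume.restrict (M.domain (n + 1))),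
      ‖divergence (M.velocity Δt (n + 1)) x‖ ≤ C := by
    have : ∀ K : M.ref.cells, ∃ C, ∀ x ∈ interior (imageCell (M.map (n + 1)) K),
        ‖divergence (M.velocity Δt (n + 1)) x‖ ≤ C := by
      intro K
      obtain ⟨J, D, -, h1, ⟨C, hC⟩, -⟩ := M.exists_jacobian_divergence hn hΔt K.2
      refine ⟨C, fun x hx => ?_⟩
      rw [← M.interp_one] at hx
      have h11 : (1 : ℝ) ∈ Icc (0 : ℝ) 1 := ⟨zero_le_one, le_rfl⟩
      rw [velocity, (h1 1 h11 x hx).1]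
      exact hC 1 h11
    choose C hC using this
    refine ⟨∑ K, |C K|, h.ae_imageDomain_iff.2 fun K hK => ?_⟩
    filter_upwards [h.ae_mem_interior_imageCell hK] with x hx
    exact (hC ⟨K, hK⟩ x hx).trans ((le_abs_self _).trans
      (Finset.single_le_sum (f := fun K => |C K|) (fun _ _ => abs_nonneg _)
        (Finset.mem_univ (⟨K, hK⟩ : M.ref.cells))))
  obtain ⟨C, hC⟩ := hb
  -- Finiteness must come first: `ENNReal.toReal` sends ⊤ to 0, which would make α₁ useless as a
  -- bound.
  have hfin : eLpNorm (divergence (M.velocity Δt (n + 1))) ⊤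
      (volume.restrict (M.domain (n + 1))) ≠ ⊤ := by
    rw [eLpNorm_exponent_top]
    exact (eLpNormEssSup_lt_top_of_ae_bound hC).ne
  filter_upwards [ae_le_eLpNormEssSup (f := divergence (M.velocity Δt (n + 1)))
    (μ := volume.restrict (M.domain (n + 1)))] with x hx
  rw [← eLpNorm_exponent_top] at hx
  have := ENNReal.toReal_mono hfin hx
  simpa [alpha₁] using this

theorem abs_jacobian_mul_divergence_le_alpha₂ {n : ℕ} (hn : n < N) {Δt : ℝ} (hΔt : 0 < Δt)
    {K : Finset (Space d)} (hK : K ∈ M.ref.cells) {J D θ : ℝ} (hθ : θ ∈ Ioo (0 : ℝ) 1)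
    (hJD : ∀ x ∈ interior (imageCell (M.interp n θ) K),
        divergence (M.stepVelocity Δt n θ) x = D ∧
        M.jacobian n (M.map n (M.interpInv n θ x)) = J) :
    |J * D| ≤ M.alpha₂ Δt n := by
  set g : ℝ → ℝ≥0∞ := fun θ => eLpNorm (fun x => M.jacobian n (M.map n (M.interpInv n θ x)) *
          divergence (M.stepVelocity Δt n θ) x) ⊤
        (volume.restrict (M.interpDomain n θ)) with hg
  have hα : M.alpha₂ Δt n = (⨆ θ ∈ Ioo (0 : ℝ) 1, g θ).toReal := by
    rw [alpha₂, if_pos hn]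
  -- Again needed because `ENNReal.toReal` sends ⊤ to 0; the bound on the divergence is uniform in θ
  -- and the cells are finitely many.
  have hfin : (⨆ θ ∈ Ioo (0 : ℝ) 1, g θ) ≠ ⊤ := by
    have : ∀ K : M.ref.cells, ∃ C, ∀ θ ∈ Icc (0 : ℝ) 1,
        ∀ x ∈ interior (imageCell (M.interp n θ) K),
        ‖M.jacobian n (M.map n (M.interpInv n θ x)) *
          divergence (M.stepVelocity Δt n θ) x‖ ≤ C := by
      intro K
      obtain ⟨J, D, -, h1, ⟨C, hC⟩, -⟩ := M.exists_jacobian_divergence hn hΔt K.2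
      refine ⟨|J| * C, fun θ hθ x hx => ?_⟩
      rw [(h1 θ hθ x hx).1, (h1 θ hθ x hx).2, norm_mul]
      exact mul_le_mul_of_nonneg_left (hC θ hθ) (abs_nonneg _)
    choose C hC using this
    refine ne_top_of_le_ne_top (ENNReal.ofReal_ne_top (r := ∑ K, |C K|)) (iSup₂_le fun θ hθ => ?_)
    rw [hg]
    simp only [eLpNorm_exponent_top]
    have h := M.isDeformation_interp hn (Ioo_subset_Icc_self hθ)
    refine eLpNormEssSup_le_of_ae_bound (h.ae_imageDomain_iff.2 fun K hK => ?_)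
    filter_upwards [h.ae_mem_interior_imageCell hK] with x hx
    exact (hC ⟨K, hK⟩ θ (Ioo_subset_Icc_self hθ) x hx).trans ((le_abs_self _).trans
      (Finset.single_le_sum (f := fun K => |C K|) (fun _ _ => abs_nonneg _)
        (Finset.mem_univ (⟨K, hK⟩ : M.ref.cells))))
  have h := M.isDeformation_interp hn (Ioo_subset_Icc_self hθ)
  have hle : ‖J * D‖ₑ ≤ g θ := by
    have hae := ae_le_eLpNormEssSup (f := fun x => M.jacobian n (M.map n (M.interpInv n θ x)) *
          divergence (M.stepVelocity Δt n θ) x) (μ := volume.restrict (M.interpDomain n θ))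
    rw [← eLpNorm_exponent_top] at hae
    have hae2 := (h.ae_imageDomain_iff.1 hae K hK).and (h.ae_mem_interior_imageCell hK)
    -- The cell has positive measure, so the a.e. bound holds at some interior point, where the
    -- integrand is the constant J · D.
    have hpos : volume.restrict (imageCell (M.interp n θ) K) ≠ 0 := by
      rw [Ne, Measure.restrict_eq_zero]
      exact ((isOpen_interior.measure_pos volume (h.interior_imageCell_nonempty hK)).trans_le
        (measure_mono interior_subset)).ne'
    have := ae_neBot.2 hpos
    obtain ⟨x, hx1, hx2⟩ := hae2.exists
    rwa [(hJD x hx2).1, (hJD x hx2).2] at hx1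
  rw [hα]
  have := ENNReal.toReal_mono hfin (hle.trans (le_iSup₂ (f := fun θ _ => g θ) θ hθ))
  simpa using this

theorem normSq_nonneg (n : ℕ) (v : Space d → ℝ) : 0 ≤ M.normSq n v :=
  integral_nonneg fun _ => sq_nonneg _

theorem alpha₁_nonneg (Δt : ℝ) (n : ℕ) : 0 ≤ M.alpha₁ Δt n := by
  cases n <;> simp [alpha₁]

theorem alpha₂_nonneg (Δt : ℝ) (n : ℕ) : 0 ≤ M.alpha₂ Δt n := by
  unfold alpha₂; split_ifs <;> simp

theorem normSq_transfer_le {n : ℕ} (hn : n < N) {Δt : ℝ} (hΔt : 0 < Δt) {v : Space d → ℝ}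
    (hv : M.ref.ContinuousOnCells (M.map n) v) :
    M.normSq (n + 1) (fun x => v (M.transfer (n + 1) n x)) ≤
      (1 + Δt * M.alpha₂ Δt n) * M.normSq n v := by
  have h₀ := M.isDeformation_map hn.le (by omega)
  have h₁ := M.isDeformation_map (Nat.succ_le_of_lt hn) (by omega)
  have hi₀ : Integrable (fun x => v x ^ 2) (volume.restrict (M.domain n)) :=
    (h₀.memLp hv 2).integrable_sq
  have hi₁ : Integrable (fun x => v (M.transfer (n + 1) n x) ^ 2)
      (volume.restrict (M.domain (n + 1))) :=
    (h₁.memLp (h₀.continuousOnCells_transfer h₁ hv) 2).integrable_sq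
  rw [normSq, normSq]
  erw [h₀.integral_imageDomain hi₀, h₁.integral_imageDomain hi₁]
  rw [Finset.mul_sum]
  refine Finset.sum_le_sum fun K hK => ?_
  obtain ⟨J, D, hJ, h1, -, ⟨θ, hθ, hlog⟩, hint⟩ := M.exists_jacobian_divergence hn hΔt hK
  have := hint (fun y => v y ^ 2)
  erw [this]
  refine mul_le_mul_of_nonneg_right ?_ (integral_nonneg fun _ => sq_nonneg _)
  have hα := M.abs_jacobian_mul_divergence_le_alpha₂ hn hΔt hK hθ
    (h1 θ (Ioo_subset_Icc_self hθ))
  have hJp : 0 < |J| := abs_pos.2 hJ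
  -- Multiplying 1 − 1/|J| ≤ log|J| = Δt D by |J| gives |J| − 1 ≤ Δt |J| D. This explains why the
  -- divergence in α₂ is weighted by the Jacobian.
  have h2 := Real.one_sub_inv_le_log_of_pos hJp
  rw [Real.log_abs, hlog] at h2
  have h3 : |J| - 1 ≤ |J| * (Δt * D θ) := by
    have := mul_le_mul_of_nonneg_left h2 hJp.le
    rwa [mul_sub, mul_inv_cancel₀ hJp.ne', mul_one] at this
  have h4 : |J| * D θ ≤ M.alpha₂ Δt n :=
    (mul_le_mul_of_nonneg_left (le_abs_self (D θ)) hJp.le).trans (by rwa [← abs_mul])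
  have h5 := mul_le_mul_of_nonneg_left h4 hΔt.le
  linarith

end ALEMotion

/-! ### Pasting Lipschitz functions -/

/-- Real induction along the segment from x to y: the Lipschitz bound from x propagates to the
right, because points just beyond a given one can be chosen in the same piece. No subdivision of the
segment is needed. -/
theorem lipschitzOnWith_of_finite_closed_cover {E F ι : Type*} [NormedAddCommGroup E]
    [NormedSpace ℝ E] [PseudoMetricSpace F] [Finite ι] {f : E → F} {s : Set E} (hs : Convex ℝ s)
    (hf : ContinuousOn f s) {C : ι → Set E} (hC : ∀ i, IsClosed (C i)) (hcov : s ⊆ ⋃ i, C i)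
    {κ : ℝ≥0} (hLip : ∀ i, LipschitzOnWith κ f (C i ∩ s)) : LipschitzOnWith κ f s := by
  refine LipschitzOnWith.of_dist_le_mul fun x hx y hy => ?_
  set γ : ℝ → E := fun t => AffineMap.lineMap x y t with hγ
  have hγc : Continuous γ := AffineMap.lineMap_continuous
  have hγs : ∀ t ∈ Icc (0 : ℝ) 1, γ t ∈ s := fun t ht => hs.lineMap_mem hx hy ht
  have hγ0 : γ 0 = x := AffineMap.lineMap_apply_zero x y
  have hγ1 : γ 1 = y := AffineMap.lineMap_apply_one x y
  have hfγ : ContinuousOn (fun t => f (γ t)) (Icc 0 1) :=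
    hf.comp hγc.continuousOn fun t ht => hγs t ht
  have hsub : Icc (0 : ℝ) 1 ⊆ {t | dist (f (γ 0)) (f (γ t)) ≤ κ * (t * dist x y)} := by
    refine IsClosed.Icc_subset_of_forall_exists_gt ?_ (by simp) ?_
    · have := isClosed_Icc.isClosed_le (continuous_dist.comp_continuousOn
        (continuousOn_const.prodMk hfγ))
        (f := fun t => dist (f (γ 0)) (f (γ t))) (g := fun t : ℝ => κ * (t * dist x y))
        (by fun_prop)
      rwa [inter_comm]
    · rintro t ⟨ht, ht01⟩ t' (htt' : t < t')
      have hmin : t < min t' 1 := lt_min htt' ht01.2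
      have hnear : ∀ᶠ r in 𝓝[>] t, r ∈ Ioo t (min t' 1) := Ioo_mem_nhdsGT hmin
      -- Finitely many pieces cover the points to the right of t, so one of them is visited
      -- arbitrarily close to t; being closed, it contains γ t as well.
      have hex : ∃ i, ∃ᶠ r in 𝓝[>] t, γ r ∈ C i := by
        by_contra hno
        push Not at hno
        obtain ⟨r, hr1, hr2⟩ := ((eventually_all.2 hno).and hnear).exists
        obtain ⟨i, hi⟩ := mem_iUnion.1 (hcov (hγs r ⟨ht01.1.trans hr2.1.le,
          hr2.2.le.trans (min_le_right _ _)⟩))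
        exact hr1 i hi
      obtain ⟨i, hi⟩ := hex
      have hti : γ t ∈ C i := (hC i).mem_of_frequently_of_tendsto hi
        ((hγc.tendsto t).mono_left nhdsWithin_le_nhds)
      obtain ⟨r, hr1, hr2⟩ := (hi.and_eventually hnear).exists
      have hr01 : r ∈ Icc (0 : ℝ) 1 := ⟨ht01.1.trans hr2.1.le, hr2.2.le.trans (min_le_right _ _)⟩
      refine ⟨r, ?_, hr2.1, hr2.2.le.trans (min_le_left _ _)⟩
      have h1 := (hLip i).dist_le_mul (γ t) ⟨hti, hγs t (Ico_subset_Icc_self ht01)⟩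
        (γ r) ⟨hr1, hγs r hr01⟩
      have h2 : dist (γ t) (γ r) = (r - t) * dist x y := by
        rw [hγ, dist_lineMap_lineMap, Real.dist_eq, abs_sub_comm, abs_of_pos (sub_pos.2 hr2.1)]
      have h3 : dist (f (γ 0)) (f (γ t)) ≤ κ * (t * dist x y) := ht
      calc dist (f (γ 0)) (f (γ r)) ≤ dist (f (γ 0)) (f (γ t)) + dist (f (γ t)) (f (γ r)) :=
            dist_triangle _ _ _
        _ ≤ κ * (t * dist x y) + κ * ((r - t) * dist x y) := add_le_add h3 (h2 ▸ h1)
        _ = κ * (r * dist x y) := by ring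
  have := hsub (right_mem_Icc.2 zero_le_one)
  simpa [hγ0, hγ1] using this

/-! ### Integration by parts -/

section Parts

variable {d : ℕ}

/-- Rademacher's theorem reduces both sides to coordinate derivatives, and the parts formula for
Lipschitz functions applies to each component of B. -/
theorem integral_divergence_mul {B : Space d → Space d} {g : Space d → ℝ} {κ κ' : ℝ≥0}
    (hB : LipschitzWith κ B) (hg : LipschitzWith κ' g) (hgs : HasCompactSupport g) :
    ∫ x, divergence B x * g x = -∫ x, fderiv ℝ g x (B x) := by
  set e : Fin d → Space d := fun i => EuclideanSpace.single i 1 with he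
  have hBi : ∀ i, LipschitzWith κ fun x => B x i := fun i =>
    LipschitzWith.of_dist_le_mul fun x y => by
      refine le_trans ?_ (hB.dist_le_mul x y)
      rw [dist_eq_norm, dist_eq_norm]
      exact PiLp.norm_apply_le (B x - B y) i
  have hfin : volume (tsupport g) ≠ ⊤ := hgs.measure_lt_top.ne
  have hi1 : ∀ i, Integrable fun x => lineDeriv ℝ (fun y => B y i) x (e i) * g x := fun i =>
    ((hBi i).memLp_lineDeriv (e i)).integrable_mul
      (memLp_one_iff_integrable.2 (hg.continuous.integrable_of_hasCompactSupport hgs))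
  have hi2 : ∀ i, Integrable fun x => fderiv ℝ g x (e i) * B x i := by
    intro i
    rw [← integrableOn_iff_integrable_of_support_subset (s := tsupport g)]
    · obtain ⟨C, hC⟩ := hgs.isCompact.exists_bound_of_continuousOn
        (hBi i).continuous.continuousOn
      refine Measure.integrableOn_of_bounded hfin (M := (κ' * ‖e i‖) * C)
        (((measurable_fderiv_apply_const ℝ g (e i)).mul
          (hBi i).continuous.measurable).aestronglyMeasurable) ?_
      refine (ae_restrict_iff' hgs.isCompact.measurableSet).2 (.of_forall fun x hx => ?_)
      rw [norm_mul]
      refine mul_le_mul ?_ (hC x hx) (norm_nonneg _) (by positivity)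
      exact (ContinuousLinearMap.le_opNorm _ _).trans
        (mul_le_mul_of_nonneg_right (norm_fderiv_le_of_lipschitz ℝ hg) (norm_nonneg _))
    · intro x hx
      refine support_fderiv_subset ℝ (fun h => hx ?_)
      simp [h]
  have h1 : ∫ x, divergence B x * g x =
      ∑ i, ∫ x, lineDeriv ℝ (fun y => B y i) x (e i) * g x := by
    rw [← integral_finsetSum _ fun i _ => hi1 i]
    refine integral_congr_ae ?_
    filter_upwards [hB.ae_differentiableAt] with x hx
    rw [← Finset.sum_mul, divergence]
    congr 1
    refine Finset.sum_congr rfl fun i _ => ?_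
    have hp : HasFDerivAt (fun y => B y i)
        ((EuclideanSpace.proj i : Space d →L[ℝ] ℝ).comp (fderiv ℝ B x)) x :=
      (EuclideanSpace.proj i : Space d →L[ℝ] ℝ).hasFDerivAt.comp x hx.hasFDerivAt
    rw [hp.differentiableAt.lineDeriv_eq_fderiv, hp.fderiv]
    rfl
  have h2 : ∫ x, fderiv ℝ g x (B x) = ∑ i, ∫ x, fderiv ℝ g x (e i) * B x i := by
    rw [← integral_finsetSum _ fun i _ => hi2 i]
    refine integral_congr_ae (.of_forall fun x => ?_)
    have hx : B x = ∑ i, B x i • e i := by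
      have := (EuclideanSpace.basisFun (Fin d) ℝ).sum_repr (B x)
      simpa [he] using this.symm
    dsimp only
    conv_lhs => rw [hx]
    rw [map_sum]
    refine Finset.sum_congr rfl fun i _ => ?_
    rw [map_smul, smul_eq_mul, mul_comm]
  rw [h1, h2, ← Finset.sum_neg_distrib]
  refine Finset.sum_congr rfl fun i _ => ?_
  rw [(hBi i).integral_lineDeriv_mul_eq hg hgs, ← integral_neg]
  refine integral_congr_ae ?_
  filter_upwards [hg.ae_differentiableAt] with x hx
  rw [hx.lineDeriv_eq_fderiv, map_neg, neg_mul]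

/-- The square of the distance of `y` from the interval `[-s, s]`. -/
def truncSq (s y : ℝ) : ℝ := max (y - s) 0 ^ 2 + max (-y - s) 0 ^ 2

/-- The derivative of `truncSq s`. -/
def truncSqDeriv (s y : ℝ) : ℝ := 2 * max (y - s) 0 - 2 * max (-y - s) 0

theorem hasDerivAt_max_zero_sq (y : ℝ) :
    HasDerivAt (fun t : ℝ => max t 0 ^ 2) (2 * max y 0) y := by
  rcases lt_trichotomy y 0 with h | rfl | h
  · rw [max_eq_right h.le, mul_zero]
    refine (hasDerivAt_const y (0 : ℝ)).congr_of_eventuallyEq ?_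
    filter_upwards [gt_mem_nhds h] with t ht
    rw [max_eq_right (le_of_lt ht)]; norm_num
  · rw [hasDerivAt_iff_isLittleO_nhds_zero]
    simp only [zero_add, max_self, mul_zero, smul_zero, sub_zero]
    have h1 : (fun h : ℝ => max h 0 ^ 2 - 0 ^ 2) =O[𝓝 0] fun h : ℝ => h ^ 2 := by
      refine Asymptotics.IsBigO.of_bound 1 (.of_forall fun t => ?_)
      rw [one_mul, Real.norm_eq_abs, Real.norm_eq_abs, zero_pow two_ne_zero, sub_zero,
        abs_of_nonneg (sq_nonneg _), abs_of_nonneg (sq_nonneg _)]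
      rcases le_total t 0 with h | h
      · simpa [max_eq_right h] using sq_nonneg t
      · rw [max_eq_left h]
    exact h1.trans_isLittleO (by simpa using Asymptotics.isLittleO_pow_id (𝕜 := ℝ) one_lt_two)
  · rw [max_eq_left h.le]
    have : HasDerivAt (fun t : ℝ => t ^ 2) (2 * y) y := by simpa using hasDerivAt_pow 2 y
    refine this.congr_of_eventuallyEq ?_
    filter_upwards [lt_mem_nhds h] with t ht
    rw [max_eq_left (le_of_lt ht)]

theorem hasDerivAt_truncSq (s y : ℝ) : HasDerivAt (truncSq s) (truncSqDeriv s y) y := by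
  have h1 := (hasDerivAt_max_zero_sq (y - s)).comp y ((hasDerivAt_id y).sub_const s)
  have h2 := (hasDerivAt_max_zero_sq (-y - s)).comp y ((hasDerivAt_neg y).sub_const s)
  refine (h1.add h2).congr_deriv ?_
  rw [truncSqDeriv]; ring

theorem truncSq_nonneg (s y : ℝ) : 0 ≤ truncSq s y := by unfold truncSq; positivity

theorem truncSq_eq_zero {s y : ℝ} (h : |y| ≤ s) : truncSq s y = 0 := by
  have := abs_le.1 h
  rw [truncSq, max_eq_right (by linarith), max_eq_right (by linarith)]; norm_num

theorem truncSqDeriv_eq_zero {s y : ℝ} (h : |y| ≤ s) : truncSqDeriv s y = 0 := by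
  have := abs_le.1 h
  rw [truncSqDeriv, max_eq_right (by linarith), max_eq_right (by linarith)]; norm_num

theorem truncSq_le {s : ℝ} (hs : 0 ≤ s) (y : ℝ) : truncSq s y ≤ y ^ 2 := by
  unfold truncSq
  rcases max_cases (y - s) 0 with ⟨h1, h1'⟩ | ⟨h1, h1'⟩ <;>
    rcases max_cases (-y - s) 0 with ⟨h2, h2'⟩ | ⟨h2, h2'⟩ <;> rw [h1, h2] <;> nlinarith

theorem abs_truncSqDeriv_le {s : ℝ} (hs : 0 ≤ s) (y : ℝ) : |truncSqDeriv s y| ≤ 2 * |y| := by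
  unfold truncSqDeriv
  rcases max_cases (y - s) 0 with ⟨h1, h1'⟩ | ⟨h1, h1'⟩ <;>
    rcases max_cases (-y - s) 0 with ⟨h2, h2'⟩ | ⟨h2, h2'⟩ <;> rw [h1, h2] <;>
    rcases abs_cases y with ⟨h3, h3'⟩ | ⟨h3, h3'⟩ <;> rw [abs_le, h3] <;> constructor <;> linarith

theorem continuous_truncSq (s : ℝ) : Continuous (truncSq s) := by
  unfold truncSq; fun_prop

theorem continuous_truncSqDeriv (s : ℝ) : Continuous (truncSqDeriv s) := by
  unfold truncSqDeriv; fun_prop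

theorem truncSq_zero (y : ℝ) : truncSq 0 y = y ^ 2 := by
  unfold truncSq
  rcases le_total y 0 with h | h
  · rw [max_eq_right (by linarith), max_eq_left (by linarith)]; ring
  · rw [max_eq_left (by linarith), max_eq_right (by linarith)]; ring

theorem truncSqDeriv_zero (y : ℝ) : truncSqDeriv 0 y = 2 * y := by
  unfold truncSqDeriv
  rcases le_total y 0 with h | h
  · rw [max_eq_right (by linarith), max_eq_left (by linarith)]; ring
  · rw [max_eq_left (by linarith), max_eq_right (by linarith)]; ring

theorem continuous_truncSq_left (y : ℝ) : Continuous fun s => truncSq s y := by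
  unfold truncSq; fun_prop

theorem continuous_truncSqDeriv_left (y : ℝ) : Continuous fun s => truncSqDeriv s y := by
  unfold truncSqDeriv; fun_prop

/-! ### Coercivity of convection plus reaction -/

variable {U : Set (Space d)} {u : Space d → ℝ} {κ : ℝ≥0}

/-- Parts are integrated against `truncSq s (u x)`, whose support stays away from the boundary, so
local Lipschitz continuity of B is enough. The pointwise lower bound replaces the divergence of B by
c − m, leaving an estimate that survives s → 0. -/
theorem convection_reaction_truncated (hU : IsOpen U) (hu : LipschitzWith κ u)
    (hus : HasCompactSupport u) (hu0 : ∀ x ∉ U, u x = 0) {B : Space d → Space d}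
    (hB : LocallyLipschitzOn U B) {c : Space d → ℝ} {m : ℝ}
    (hc : IntegrableOn (fun x => (c x - m) * u x ^ 2) U)
    (hcm : AEStronglyMeasurable c (volume.restrict U))
    (hm : ∀ᵐ x ∂(volume.restrict U), m ≤ c x - 1 / 2 * divergence B x) {s : ℝ} (hs : 0 < s) :
    -(1 / 2 * ∫ x in U, truncSqDeriv s (u x) * fderiv ℝ u x (B x)) ≤
      ∫ x in U, (c x - m) * truncSq s (u x) := by
  have huc := hu.continuous
  -- Since s > 0 and u vanishes off U, this set is compact and contained in U; the truncated square
  -- and its derivative vanish outside it.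
  set Q : Set (Space d) := {x | s ≤ |u x|} with hQ
  have hQU : Q ⊆ U := fun x hx => by
    by_contra h
    have : s ≤ |u x| := hx
    rw [hu0 x h, abs_zero] at this
    linarith
  have hQc : IsCompact Q := by
    refine hus.isCompact.of_isClosed_subset (isClosed_le continuous_const huc.abs) fun x hx => ?_
    refine subset_tsupport u (fun h => ?_)
    have : s ≤ |u x| := hx
    rw [h, abs_zero] at this
    linarith
  -- A compact neighbourhood of Q, not just Q, is used so that the extended field agrees with B near
  -- Q and has the same divergence there.
  obtain ⟨L, hLc, hQL, hLU⟩ := exists_compact_between hQc hU hQU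
  obtain ⟨κB, hκB⟩ := LocallyLipschitzOn.exists_lipschitzOnWith_of_compact hLc (hB.mono hLU)
  obtain ⟨B', hB', hBB'⟩ := hκB.extend_finite_dimension
  set g : Space d → ℝ := fun x => truncSq s (u x) with hg
  have hout : ∀ x ∉ Q, |u x| ≤ s := fun x hx => (not_le.1 hx).le
  have hg0 : ∀ x ∉ Q, g x = 0 := fun x hx => truncSq_eq_zero (hout x hx)
  have hgs : HasCompactSupport g := HasCompactSupport.intro hQc hg0
  obtain ⟨R, hR⟩ := huc.bounded_above_of_compact_support hus
  have hgL : LipschitzWith (Real.toNNReal (2 * R) * κ) g := by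
    rw [← lipschitzOnWith_univ]
    refine LipschitzOnWith.comp (t := Icc (-R) R) (g := truncSq s) ?_
      (lipschitzOnWith_univ.2 hu) fun x _ => abs_le.1 (hR x)
    refine Convex.lipschitzOnWith_of_nnnorm_hasDerivWithin_le (convex_Icc _ _)
      (fun y _ => (hasDerivAt_truncSq s y).hasDerivWithinAt) fun y hy => ?_
    rw [← NNReal.coe_le_coe, coe_nnnorm, Real.norm_eq_abs]
    refine (abs_truncSqDeriv_le hs.le y).trans (le_trans ?_ (Real.le_coe_toNNReal _))
    have := abs_le.2 hy
    linarith
  have hparts := integral_divergence_mul hB' hgL hgs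
  have hfd : ∫ x, fderiv ℝ g x (B' x) =
      ∫ x in U, truncSqDeriv s (u x) * fderiv ℝ u x (B x) := by
    rw [setIntegral_eq_integral_of_forall_compl_eq_zero]
    · refine integral_congr_ae ?_
      filter_upwards [hu.ae_differentiableAt] with x hx
      have h1 : HasFDerivAt g (truncSqDeriv s (u x) • fderiv ℝ u x) x :=
        (hasDerivAt_truncSq s (u x)).comp_hasFDerivAt x hx.hasFDerivAt
      rw [h1.fderiv, smul_apply, smul_eq_mul]
      by_cases hxQ : x ∈ Q
      · rw [hBB' (interior_subset (hQL hxQ))]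
      · rw [truncSqDeriv_eq_zero (hout x hxQ), zero_mul, zero_mul]
    · intro x hx
      rw [truncSqDeriv_eq_zero (hout x fun h => hx (hQU h)), zero_mul]
  have hdiv : ∫ x, divergence B' x * g x = ∫ x in U, divergence B' x * g x := by
    rw [setIntegral_eq_integral_of_forall_compl_eq_zero]
    intro x hx
    rw [hg0 x fun h => hx (hQU h), mul_zero]
  rw [hfd, hdiv] at hparts
  rw [← mul_neg, ← hparts, ← integral_const_mul]
  have hgm : AEStronglyMeasurable g (volume.restrict U) :=
    hgL.continuous.aestronglyMeasurable
  -- The comparison is between ½ div B' · g and (c − m) · g. The divergence of the extension B' is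
  -- bounded, hence harmless, whereas that of B need not be integrable.
  refine integral_mono_ae ?_ ?_ ?_
  · refine Integrable.const_mul ?_ _
    refine Integrable.integrableOn ?_
    have hmeas : Measurable (divergence B') :=
      Finset.measurable_sum _ fun i _ => by
        have := measurable_fderiv_apply_const ℝ B' (EuclideanSpace.single i (1 : ℝ))
        exact (EuclideanSpace.proj i : Space d →L[ℝ] ℝ).continuous.measurable.comp this
    have hbd : ∀ x, ‖divergence B' x‖ ≤ 
        ∑ _i : Fin d, (lipschitzExtensionConstant (Space d) * κB : ℝ≥0) := by
      intro x
      refine (norm_sum_le _ _).trans ?_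
      push_cast
      refine Finset.sum_le_sum fun i _ => ?_
      refine (PiLp.norm_apply_le _ i).trans ((ContinuousLinearMap.le_opNorm _ _).trans ?_)
      rw [PiLp.norm_single, norm_one, mul_one]
      exact_mod_cast norm_fderiv_le_of_lipschitz ℝ hB'
    exact (hgL.continuous.integrable_of_hasCompactSupport hgs).bdd_mul
      hmeas.aestronglyMeasurable (.of_forall hbd)
  · refine Integrable.mono hc ((hcm.sub aestronglyMeasurable_const).mul hgm)
      (.of_forall fun x => ?_)
    rw [norm_mul, norm_mul]
    refine mul_le_mul_of_nonneg_left ?_ (norm_nonneg _)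
    rw [Real.norm_of_nonneg (truncSq_nonneg _ _), Real.norm_of_nonneg (sq_nonneg _)]
    exact truncSq_le hs.le _
  · filter_upwards [hm] with x hx
    by_cases hxQ : x ∈ Q
    · have hev : B' =ᶠ[𝓝 x] B := by
        filter_upwards [isOpen_interior.mem_nhds (hQL hxQ)] with y hy
        exact (hBB' (interior_subset hy)).symm
      have hd : divergence B' x = divergence B x := by
        unfold divergence; rw [hev.fderiv_eq]
      rw [hd, ← mul_assoc]
      exact mul_le_mul_of_nonneg_right (by linarith) (truncSq_nonneg _ _)
    · have : truncSq s (u x) = 0 := truncSq_eq_zero (hout x hxQ)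
      simp [hg, this]

/-- Dominated convergence with s = 1/(n+1) in the truncated estimate, available because u is
Lipschitz, B is bounded and c is essentially bounded. -/
theorem convection_reaction_coercive (hU : IsOpen U) (hu : LipschitzWith κ u)
    (hus : HasCompactSupport u) (hu0 : ∀ x ∉ U, u x = 0) {B : Space d → Space d}
    (hB : LocallyLipschitzOn U B) {C : ℝ} (hBC : ∀ x ∈ U, ‖B x‖ ≤ C) {c : Space d → ℝ} {m : ℝ}
    (hc : MemLp c ⊤ (volume.restrict U))
    (hm : ∀ᵐ x ∂(volume.restrict U), m ≤ c x - 1 / 2 * divergence B x) :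
    m * ∫ x in U, u x ^ 2 ≤
      (∫ x in U, fderiv ℝ u x (B x) * u x) + ∫ x in U, c x * u x * u x := by
  have huc := hu.continuous
  have hui : IntegrableOn u U := (huc.integrable_of_hasCompactSupport hus).integrableOn
  have hu2i : IntegrableOn (fun x => u x ^ 2) U := by
    have h : Integrable (u * u) := (huc.mul huc).integrable_of_hasCompactSupport hus.mul_left
    have h2 : (fun x => u x ^ 2) = u * u := by funext x; exact sq (u x)
    rw [h2]
    exact h.integrableOn
  have hcu : IntegrableOn (fun x => c x * u x ^ 2) U := by
    have h : Integrable (c * fun x => u x ^ 2) (volume.restrict U) :=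
      hc.integrable_mul (memLp_one_iff_integrable.2 hu2i)
    exact h
  have hci : IntegrableOn (fun x => (c x - m) * u x ^ 2) U := by
    have : (fun x => (c x - m) * u x ^ 2) = fun x => c x * u x ^ 2 - m * u x ^ 2 := by
      funext x; ring
    rw [this]
    exact hcu.sub (hu2i.const_mul m)
  have hBm : AEStronglyMeasurable B (volume.restrict U) :=
    hB.continuousOn.aestronglyMeasurable hU.measurableSet
  have hfm : AEStronglyMeasurable (fun x => fderiv ℝ u x (B x)) (volume.restrict U) := by
    have h1 : AEStronglyMeasurable (fderiv ℝ u) (volume.restrict U) :=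
      (measurable_fderiv ℝ u).aestronglyMeasurable
    exact (ContinuousLinearMap.apply ℝ ℝ : Space d →L[ℝ] (Space d →L[ℝ] ℝ) →L[ℝ] ℝ).flip
      |>.aestronglyMeasurable_comp₂ h1 hBm
  have hfb : ∀ x ∈ U, ‖fderiv ℝ u x (B x)‖ ≤ κ * C := fun x hx =>
    (ContinuousLinearMap.le_opNorm _ _).trans (mul_le_mul (norm_fderiv_le_of_lipschitz ℝ hu)
      (hBC x hx) (norm_nonneg _) κ.2)
  set s : ℕ → ℝ := fun n => 1 / ((n : ℝ) + 1) with hs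
  have hs0 : ∀ n, 0 < s n := fun n => Nat.one_div_pos_of_nat
  have hst : Tendsto s atTop (𝓝 0) := tendsto_one_div_add_atTop_nhds_zero_nat
  have h1 : Tendsto (fun n => ∫ x in U, truncSqDeriv (s n) (u x) * fderiv ℝ u x (B x)) atTop
      (𝓝 (∫ x in U, 2 * u x * fderiv ℝ u x (B x))) := by
    refine tendsto_integral_of_dominated_convergence (fun x => 2 * |u x| * (κ * C))
      (fun n => (((continuous_truncSqDeriv _).comp huc).aestronglyMeasurable).mul hfm)
      ((hui.norm.const_mul 2).mul_const _) (fun n => ?_) (.of_forall fun x => ?_)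
    · refine (ae_restrict_iff' hU.measurableSet).2 (.of_forall fun x hx => ?_)
      rw [norm_mul]
      exact mul_le_mul (abs_truncSqDeriv_le (hs0 n).le _) (hfb x hx) (norm_nonneg _)
        (by positivity)
    · rw [← truncSqDeriv_zero]
      exact (((continuous_truncSqDeriv_left (u x)).tendsto 0).comp hst).mul_const _
  have h2 : Tendsto (fun n => ∫ x in U, (c x - m) * truncSq (s n) (u x)) atTop
      (𝓝 (∫ x in U, (c x - m) * u x ^ 2)) := by
    refine tendsto_integral_of_dominated_convergence (fun x => ‖(c x - m) * u x ^ 2‖)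
      (fun n => (hc.1.sub aestronglyMeasurable_const).mul
        (((continuous_truncSq _).comp huc).aestronglyMeasurable)) hci.norm
      (fun n => .of_forall fun x => ?_) (.of_forall fun x => ?_)
    · rw [norm_mul, norm_mul]
      refine mul_le_mul_of_nonneg_left ?_ (norm_nonneg _)
      rw [Real.norm_of_nonneg (truncSq_nonneg _ _), Real.norm_of_nonneg (sq_nonneg _)]
      exact truncSq_le (hs0 n).le _
    · rw [← truncSq_zero]
      exact (((continuous_truncSq_left (u x)).tendsto 0).comp hst).const_mul _
  have h3 := le_of_tendsto_of_tendsto' (h1.const_mul (1 / 2)).neg h2 fun n =>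
    convection_reaction_truncated hU hu hus hu0 hB hci hc.1 hm (hs0 n)
  have h4 : ∫ x in U, 2 * u x * fderiv ℝ u x (B x) =
      2 * ∫ x in U, fderiv ℝ u x (B x) * u x := by
    rw [← integral_const_mul]; congr 1; funext x; ring
  have h5 : ∫ x in U, (c x - m) * u x ^ 2 =
      (∫ x in U, c x * u x * u x) - m * ∫ x in U, u x ^ 2 := by
    rw [← integral_const_mul, ← integral_sub]
    · congr 1; funext x; ring
    · refine hcu.congr (.of_forall fun x => ?_)
      dsimp only; ring
    · exact hu2i.const_mul m
  rw [h4, h5] at h3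
  linarith

end Parts


/-! ### Regularity and integration by parts for discrete functions -/

section Discretization
variable {d : ℕ}

theorem exists_lipschitzWith_affineMap (g : Space d →ᵃ[ℝ] Space d) : ∃ κ, LipschitzWith κ g := by
  refine ⟨‖LinearMap.toContinuousLinearMap g.linear‖₊, ?_⟩
  refine lipschitzWith_of_nnnorm_fderiv_le
    (fun x => (hasFDerivAt_affineMap g x).differentiableAt) fun x => ?_
  rw [(hasFDerivAt_affineMap g x).fderiv]

theorem contDiff_mvPolynomial_eval (p : MvPolynomial (Fin d) ℝ) :
    ContDiff ℝ 2 fun x : Space d => MvPolynomial.eval (fun i => x i) p :=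
  (AnalyticOnNhd.eval_continuousLinearMap'
    (fun i => (EuclideanSpace.proj i : Space d →L[ℝ] ℝ)) p).contDiff

theorem continuous_laplacian {f : Space d → ℝ} (hf : ContDiff ℝ 2 f) :
    Continuous (Laplacian.laplacian f) := by
  rw [InnerProductSpace.laplacian_eq_iteratedFDeriv_orthonormalBasis f
    (EuclideanSpace.basisFun (Fin d) ℝ)]
  have h := hf.continuous_iteratedFDeriv (m := 2) le_rfl
  refine continuous_finsetSum _ fun i _ => ?_
  exact (ContinuousMultilinearMap.apply ℝ (fun _ : Fin 2 => Space d) ℝ _).continuous.comp h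

theorem measurable_gradient (v : Space d → ℝ) : Measurable (gradient v) :=
  (InnerProductSpace.toDual ℝ (Space d)).symm.continuous.measurable.comp (measurable_fderiv ℝ v)

theorem norm_gradient (v : Space d → ℝ) (x : Space d) : ‖gradient v x‖ = ‖fderiv ℝ v x‖ := by
  simp [gradient]

namespace Triangulation.IsDeformation

variable {T : Triangulation d} {φ : Space d → Space d} {E : Type*} [NormedAddCommGroup E]

theorem continuousOn_closure (h : T.IsDeformation φ) {F : Space d → E}
    (hF : T.ContinuousOnCells φ F) : ContinuousOn F (closure (T.imageDomain φ)) := by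
  rw [h.closure_imageDomain]
  exact (locallyFinite_of_finite _).continuousOn_iUnion
    (fun K => (h.isCompact_imageCell K.2).isClosed) fun K => hF K K.2

/-- A small ball is convex and covered by finitely many closed cells, so the cellwise constants can
be pasted; their sum dominates each of them. -/
theorem locallyLipschitzOn_interior (h : T.IsDeformation φ) {F : Space d → E}
    (hF : ∀ K ∈ T.cells, ∃ κ, LipschitzOnWith κ F (imageCell φ K)) :
    LocallyLipschitzOn (interior (T.imageDomain φ)) F := by
  have hF' : ∀ K : T.cells, ∃ κ, LipschitzOnWith κ F (imageCell φ K) := fun K => hF K K.2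
  choose κ hκ using hF'
  have hcont := h.continuousOn_closure (F := F) fun K hK => (hκ ⟨K, hK⟩).continuousOn
  intro x hx
  obtain ⟨r, hr, hball⟩ := Metric.isOpen_iff.1 isOpen_interior x hx
  have hsub : Metric.ball x r ⊆ closure (T.imageDomain φ) :=
    hball.trans (interior_subset.trans subset_closure)
  refine ⟨∑ K, κ K, Metric.ball x r, mem_nhdsWithin_of_mem_nhds (Metric.ball_mem_nhds x hr), ?_⟩
  refine lipschitzOnWith_of_finite_closed_cover (convex_ball x r) (hcont.mono hsub)
    (fun K : T.cells => (h.isCompact_imageCell K.2).isClosed)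
    (by rwa [h.closure_imageDomain] at hsub) fun K => ?_
  exact ((hκ K).mono inter_subset_left).weaken
    (Finset.single_le_sum (f := κ) (fun _ _ => zero_le) (Finset.mem_univ K))

end Triangulation.IsDeformation

namespace ALEMotion

variable {N : ℕ} (M : ALEMotion d N)

/-! ### The mesh velocity -/

theorem exists_affine_velocity {n : ℕ} (hn : n < N) (Δt : ℝ) {K : Finset (Space d)}
    (hK : K ∈ M.ref.cells) :
    ∃ g : Space d →ᵃ[ℝ] Space d, EqOn (M.velocity Δt (n + 1)) g (imageCell (M.map (n + 1)) K) := by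
  have h₀ := M.isDeformation_map hn.le (by omega)
  have h₁ := M.isDeformation_map (Nat.succ_le_of_lt hn) (by omega)
  obtain ⟨e₀, he₀⟩ := h₀.exists_affineEquiv hK
  obtain ⟨e₁, he₁⟩ := h₁.exists_affineEquiv hK
  refine ⟨(Δt⁻¹ • (e₁.toAffineMap - e₀.toAffineMap)).comp e₁.symm.toAffineMap, fun x hx => ?_⟩
  have hY := h₁.inverse_mem hK hx
  have hinv : M.interpInv n 1 = M.ref.inverse (M.map (n + 1)) := by
    rw [← M.interp_one]; rfl
  simp only [velocity, stepVelocity, hinv]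
  rw [he₀ hY, he₁ hY, h₁.inverse_eqOn hK he₁ hx]
  simp

theorem continuousOnCells_velocity {n : ℕ} (hn : n < N) (Δt : ℝ) :
    M.ref.ContinuousOnCells (M.map (n + 1)) (M.velocity Δt (n + 1)) := fun K hK => by
  obtain ⟨g, hg⟩ := M.exists_affine_velocity hn Δt hK
  exact (continuous_affineMap g).continuousOn.congr hg

theorem locallyLipschitzOn_neg_velocity {n : ℕ} (hn : n < N) (Δt : ℝ) :
    LocallyLipschitzOn (interior (M.domain (n + 1))) fun x => -M.velocity Δt (n + 1) x := by
  refine (M.isDeformation_map (Nat.succ_le_of_lt hn) (by omega)).locallyLipschitzOn_interior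
    fun K hK => ?_
  obtain ⟨g, hg⟩ := M.exists_affine_velocity hn Δt hK
  obtain ⟨κ, hκ⟩ := exists_lipschitzWith_affineMap g
  refine ⟨κ, LipschitzOnWith.of_dist_le_mul fun x hx y hy => ?_⟩
  rw [dist_neg_neg, hg hx, hg hy]
  exact hκ.dist_le_mul x y

/-! ### Finite element functions -/

section FiniteElement

variable {M} {k n : ℕ} {v : Space d → ℝ}

theorem continuousOnCells_of_mem_feSpace (h : M.ref.IsDeformation (M.map n))
    (hv : v ∈ M.feSpace k n) : M.ref.ContinuousOnCells (M.map n) v :=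
  fun _ hK => hv.1.mono (h.imageCell_subset_closure hK)

theorem indicator_eq_zero_of_notMem_interior (hv : v ∈ M.feSpace k n) {x : Space d}
    (hx : x ∉ interior (M.domain n)) : (closure (M.domain n)).indicator v x = 0 := by
  by_cases h : x ∈ closure (M.domain n)
  · rw [indicator_of_mem h]
    exact hv.2.1 x ⟨h, hx⟩
  · exact indicator_of_notMem h v

/-- The boundary values are zero, so the extension by zero is continuous; it is polynomial on each
compact convex cell, and pasting makes it Lipschitz on the whole space. -/
theorem exists_lipschitzWith_indicator (h : M.ref.IsDeformation (M.map n))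
    (hv : v ∈ M.feSpace k n) : ∃ κ, LipschitzWith κ ((closure (M.domain n)).indicator v) := by
  set w := (closure (M.domain n)).indicator v with hw
  have hwc : Continuous w := by
    refine continuous_indicator (fun x hx => hv.2.1 x (frontier_closure_subset hx)) ?_
    rw [closure_closure]
    exact hv.1
  have hcell : ∀ K : M.ref.cells, ∃ κ, LipschitzOnWith κ w (imageCell (M.map n) K) := by
    intro K
    obtain ⟨p, -, hp⟩ := hv.2.2 K K.2
    obtain ⟨κ, hκ⟩ := (contDiff_mvPolynomial_eval p).contDiffOn.exists_lipschitzOnWith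
      two_ne_zero (h.convex_imageCell K.2) (h.isCompact_imageCell K.2)
    refine ⟨κ, LipschitzOnWith.of_dist_le_mul fun x hx y hy => ?_⟩
    have hsub : imageCell (M.map n) K ⊆ closure (M.domain n) := h.imageCell_subset_closure K.2
    rw [hw, indicator_of_mem (hsub hx), indicator_of_mem (hsub hy), hp x hx, hp y hy]
    exact hκ.dist_le_mul x hx y hy
  choose κ hκ using hcell
  refine ⟨∑ K, κ K, ?_⟩
  rw [← lipschitzOnWith_univ]
  -- The extra index `none` adds the complement of the interior of the domain, where the extension
  -- vanishes.
  refine lipschitzOnWith_of_finite_closed_cover (ι := Option M.ref.cells)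
    (C := fun o => o.elim (interior (M.domain n))ᶜ fun K => imageCell (M.map n) K)
    convex_univ hwc.continuousOn ?_ ?_ ?_
  · rintro (_ | K)
    · exact isOpen_interior.isClosed_compl
    · exact (h.isCompact_imageCell K.2).isClosed
  · intro x _
    by_cases hx : x ∈ interior (M.domain n)
    · have : x ∈ closure (M.domain n) := subset_closure (interior_subset hx)
      erw [h.closure_imageDomain] at this
      obtain ⟨K, hK⟩ := mem_iUnion.1 this
      exact mem_iUnion.2 ⟨some K, hK⟩
    · exact mem_iUnion.2 ⟨none, hx⟩
  · rintro (_ | K)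
    · refine LipschitzOnWith.of_dist_le_mul fun x hx y hy => ?_
      rw [hw, indicator_eq_zero_of_notMem_interior hv hx.1,
        indicator_eq_zero_of_notMem_interior hv hy.1, dist_self]
      positivity
    · exact ((hκ K).mono inter_subset_left).weaken
        (Finset.single_le_sum (f := κ) (fun _ _ => zero_le) (Finset.mem_univ K))

theorem fderiv_indicator_eq {x : Space d} (hx : x ∈ interior (M.domain n)) :
    fderiv ℝ ((closure (M.domain n)).indicator v) x = fderiv ℝ v x := by
  refine Filter.EventuallyEq.fderiv_eq ?_
  filter_upwards [isOpen_interior.mem_nhds hx] with y hy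
  exact indicator_of_mem (subset_closure (interior_subset hy)) v

theorem ae_mem_interior_domain (h : M.ref.IsDeformation (M.map n)) :
    ∀ᵐ x ∂(volume.restrict (M.domain n)), x ∈ interior (M.domain n) := by
  erw [← Measure.restrict_congr_set h.interior_imageDomain_ae_eq]
  exact ae_restrict_mem isOpen_interior.measurableSet

theorem exists_bound_gradient (h : M.ref.IsDeformation (M.map n)) (hv : v ∈ M.feSpace k n) :
    ∃ C, ∀ᵐ x ∂(volume.restrict (M.domain n)), ‖gradient v x‖ ≤ C := by
  obtain ⟨κ, hκ⟩ := exists_lipschitzWith_indicator h hv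
  refine ⟨κ, ?_⟩
  filter_upwards [ae_mem_interior_domain h] with x hx
  rw [norm_gradient, ← fderiv_indicator_eq hx]
  exact norm_fderiv_le_of_lipschitz ℝ hκ

theorem memLp_gradient (h : M.ref.IsDeformation (M.map n)) (hv : v ∈ M.feSpace k n)
    (p : ℝ≥0∞) : MemLp (gradient v) p (volume.restrict (M.domain n)) := by
  obtain ⟨C, hC⟩ := exists_bound_gradient h hv
  exact h.memLp_top_of_bound (measurable_gradient v).aestronglyMeasurable hC p

/-- At interior points of a cell the Laplacian is that of the local polynomial; its values on the
cell boundaries do not matter, these being null. -/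
theorem memLp_laplacian (h : M.ref.IsDeformation (M.map n)) (hv : v ∈ M.feSpace k n)
    (p : ℝ≥0∞) : MemLp (Laplacian.laplacian v) p (volume.restrict (M.domain n)) := by
  have hcell : ∀ K : M.ref.cells, AEStronglyMeasurable (Laplacian.laplacian v)
      (volume.restrict (imageCell (M.map n) K)) ∧ ∃ C,
      ∀ᵐ x ∂(volume.restrict (imageCell (M.map n) K)), ‖Laplacian.laplacian v x‖ ≤ C := by
    intro K
    obtain ⟨q, -, hq⟩ := hv.2.2 K K.2
    have hcont := continuous_laplacian (contDiff_mvPolynomial_eval q)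
    have hev : ∀ᵐ x ∂(volume.restrict (imageCell (M.map n) K)), Laplacian.laplacian v x =
        Laplacian.laplacian (fun x : Space d => MvPolynomial.eval (fun i => x i) q) x := by
      filter_upwards [h.ae_mem_interior_imageCell K.2] with x hx
      refine (InnerProductSpace.laplacian_congr_nhds ?_).eq_of_nhds
      filter_upwards [mem_interior_iff_mem_nhds.1 hx] with y hy
      exact hq y hy
    refine ⟨hcont.aestronglyMeasurable.congr (Filter.EventuallyEq.symm hev), ?_⟩
    obtain ⟨C, hC⟩ := (h.isCompact_imageCell K.2).exists_bound_of_continuousOn hcont.continuousOn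
    refine ⟨C, ?_⟩
    filter_upwards [hev, ae_restrict_mem (h.measurableSet_imageCell K.2)] with x hx hxK
    rw [hx]
    exact hC x hxK
  choose hm C hC using hcell
  refine h.memLp_top_of_bound (C := ∑ K, |C K|) (h.aestronglyMeasurable fun K hK => hm ⟨K, hK⟩)
    (h.ae_imageDomain_iff.2 fun K hK => ?_) p
  filter_upwards [hC ⟨K, hK⟩] with x hx
  exact hx.trans ((le_abs_self _).trans (Finset.single_le_sum (f := fun K => |C K|)
    (fun _ _ => abs_nonneg _) (Finset.mem_univ (⟨K, hK⟩ : M.ref.cells))))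

theorem convection_reaction_feSpace (h : M.ref.IsDeformation (M.map n)) (hv : v ∈ M.feSpace k n)
    {B : Space d → Space d} (hB : LocallyLipschitzOn (interior (M.domain n)) B) {C : ℝ}
    (hBC : ∀ x ∈ interior (M.domain n), ‖B x‖ ≤ C) {c : Space d → ℝ} {m : ℝ}
    (hc : MemLp c ⊤ (volume.restrict (M.domain n)))
    (hm : ∀ᵐ x ∂(volume.restrict (M.domain n)), m ≤ c x - 1 / 2 * divergence B x) :
    m * M.normSq n v ≤ (∫ x in M.domain n, inner ℝ (B x) (gradient v x) * v x) +
      ∫ x in M.domain n, c x * v x * v x := by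
  obtain ⟨κ, hκ⟩ := exists_lipschitzWith_indicator h hv
  have hres : volume.restrict (interior (M.domain n)) = volume.restrict (M.domain n) :=
    Measure.restrict_congr_set h.interior_imageDomain_ae_eq
  have hsupp : HasCompactSupport ((closure (M.domain n)).indicator v) :=
    HasCompactSupport.intro h.isCompact_closure_imageDomain fun x hx => indicator_of_notMem hx v
  have key := convection_reaction_coercive isOpen_interior hκ hsupp
    (fun x hx => indicator_eq_zero_of_notMem_interior hv hx) hB hBC (by rwa [hres])
    (by rwa [hres])
  have hind : ∀ x ∈ interior (M.domain n), (closure (M.domain n)).indicator v x = v x :=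
    fun x hx => indicator_of_mem (subset_closure (interior_subset hx)) v
  have hmeas : MeasurableSet (interior (M.domain n)) := isOpen_interior.measurableSet
  have h1 : ∫ x in interior (M.domain n), (closure (M.domain n)).indicator v x ^ 2 =
      M.normSq n v := by
    rw [normSq, ← hres]
    exact setIntegral_congr_fun hmeas fun x hx => by simp only [hind x hx]
  have h2 : ∫ x in interior (M.domain n), fderiv ℝ ((closure (M.domain n)).indicator v) x (B x) *
      (closure (M.domain n)).indicator v x =
      ∫ x in M.domain n, inner ℝ (B x) (gradient v x) * v x := by
    rw [← hres]
    refine setIntegral_congr_fun hmeas fun x hx => ?_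
    simp only [hind x hx, fderiv_indicator_eq hx, inner_gradient_right]
    rfl
  have h3 : ∫ x in interior (M.domain n), c x * (closure (M.domain n)).indicator v x *
      (closure (M.domain n)).indicator v x = ∫ x in M.domain n, c x * v x * v x := by
    rw [← hres]
    exact setIntegral_congr_fun hmeas fun x hx => by simp only [hind x hx]
  rwa [h1, h2, h3] at key

end FiniteElement

theorem mesh_velocity_term_le {k n : ℕ} (hn : n < N) {Δt : ℝ} (hΔt : 0 < Δt) {v : Space d → ℝ}
    (hv : v ∈ M.feSpace k (n + 1)) :
    ∫ x in M.domain (n + 1), inner ℝ (M.velocity Δt (n + 1) x) (gradient v x) * v x ≤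
      1 / 2 * M.alpha₁ Δt (n + 1) * M.normSq (n + 1) v := by
  have h := M.isDeformation_map (Nat.succ_le_of_lt hn) (by omega)
  obtain ⟨C, hC⟩ := h.exists_bound (M.continuousOnCells_velocity hn Δt)
  -- The coercivity estimate is reused with field −w, zero reaction and m = −½α₁.
  have key := convection_reaction_feSpace h hv (M.locallyLipschitzOn_neg_velocity hn Δt)
    (C := C) (fun x hx => by
      rw [norm_neg]; exact hC x (subset_closure (interior_subset hx))) (c := fun _ => 0)
    (m := -(1 / 2 * M.alpha₁ Δt (n + 1))) MemLp.zero' (by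
      filter_upwards [M.abs_divergence_le_alpha₁ hn hΔt] with x hx
      have hneg : divergence (fun x => -M.velocity Δt (n + 1) x) x =
          -divergence (M.velocity Δt (n + 1)) x := by
        simp [divergence, fderiv_fun_neg]
      rw [hneg]
      have := (abs_le.1 hx).1
      linarith)
  simp only [inner_neg_left, neg_mul, zero_mul, integral_zero, add_zero, integral_neg] at key
  linarith

end ALEMotion

end Discretization

/-! ### Integral inequalities -/

section Integral

variable {X : Type*} [MeasurableSpace X] {ν : Measure X}

/-- The difference of the integrands is the sum of squares (s/2 + L)² + (s/2 + q)². -/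
theorem integral_residual_mul_ge {L s q : X → ℝ} (hL : MemLp L 2 ν) (hs : MemLp s 2 ν)
    (hq : MemLp q 2 ν) :
    1 / 2 * (∫ x, s x ^ 2 ∂ν) - (∫ x, L x ^ 2 ∂ν) - ∫ x, q x ^ 2 ∂ν ≤
      ∫ x, (L x + s x + q x) * s x ∂ν := by
  have h1 : Integrable (fun x => 1 / 2 * s x ^ 2 - L x ^ 2) ν :=
    (hs.integrable_sq.const_mul _).sub hL.integrable_sq
  rw [← integral_const_mul, ← integral_sub (hs.integrable_sq.const_mul _) hL.integrable_sq,
    ← integral_sub h1 hq.integrable_sq]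
  refine integral_mono (h1.sub hq.integrable_sq) (((hL.add hs).add hq).integrable_mul hs) fun x => ?_
  dsimp only
  nlinarith [sq_nonneg (s x / 2 + L x), sq_nonneg (s x / 2 + q x)]

theorem integral_mul_le_weighted {f g : X → ℝ} (hf : MemLp f 2 ν) (hg : MemLp g 2 ν) {η : ℝ}
    (hη : 0 < η) :
    ∫ x, f x * g x ∂ν ≤ 1 / η * (∫ x, f x ^ 2 ∂ν) + η / 4 * ∫ x, g x ^ 2 ∂ν := by
  rw [← integral_const_mul, ← integral_const_mul,
    ← integral_add (hf.integrable_sq.const_mul _) (hg.integrable_sq.const_mul _)]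
  refine integral_mono (hf.integrable_mul hg)
    ((hf.integrable_sq.const_mul _).add (hg.integrable_sq.const_mul _)) fun x => ?_
  dsimp only
  have h1 : 1 / η * f x ^ 2 + η / 4 * g x ^ 2 - f x * g x = 1 / η * (f x - η / 2 * g x) ^ 2 := by
    field_simp; ring
  have h2 : 0 ≤ 1 / η * (f x - η / 2 * g x) ^ 2 := by positivity
  linarith

/-- The two sides differ by the integral of the square of the second difference a − 2b + c, which is
discarded. -/
theorem integral_bdf2_mul_ge {a b c : X → ℝ} (ha : MemLp a 2 ν) (hb : MemLp b 2 ν)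
    (hc : MemLp c 2 ν) {τ : ℝ} (hτ : 0 < τ) :
    (∫ x, a x ^ 2 ∂ν) + (∫ x, (2 * a x - b x) ^ 2 ∂ν) - (∫ x, b x ^ 2 ∂ν) -
        ∫ x, (2 * b x - c x) ^ 2 ∂ν ≤
      4 * τ * ∫ x, (3 / 2 * a x - 2 * b x + 1 / 2 * c x) / τ * a x ∂ν := by
  have hab : Integrable (fun x => (2 * a x - b x) ^ 2) ν :=
    ((ha.const_mul 2).sub hb).integrable_sq
  have hbc : Integrable (fun x => (2 * b x - c x) ^ 2) ν :=
    ((hb.const_mul 2).sub hc).integrable_sq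
  have hl : Integrable (fun x => (3 / 2 * a x - 2 * b x + 1 / 2 * c x) / τ * a x) ν := by
    have h : MemLp (fun x => τ⁻¹ * (3 / 2 * a x - 2 * b x + 1 / 2 * c x)) 2 ν :=
      (((ha.const_mul (3 / 2)).sub (hb.const_mul 2)).add (hc.const_mul (1 / 2))).const_mul τ⁻¹
    refine (h.integrable_mul ha).congr (.of_forall fun x => ?_)
    simp only [Pi.mul_apply]
    ring
  have h1 : Integrable (fun x => a x ^ 2 + (2 * a x - b x) ^ 2) ν := ha.integrable_sq.add hab
  have h2 : Integrable (fun x => a x ^ 2 + (2 * a x - b x) ^ 2 - b x ^ 2) ν :=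
    h1.sub hb.integrable_sq
  rw [← integral_const_mul, ← integral_add ha.integrable_sq hab,
    ← integral_sub h1 hb.integrable_sq, ← integral_sub h2 hbc]
  refine integral_mono (h2.sub hbc)
    (hl.const_mul _) fun x => ?_
  dsimp only
  have h1 : 4 * τ * ((3 / 2 * a x - 2 * b x + 1 / 2 * c x) / τ * a x) =
      4 * ((3 / 2 * a x - 2 * b x + 1 / 2 * c x) * a x) := by field_simp
  rw [h1]
  nlinarith [sq_nonneg (a x - 2 * b x + c x)]

theorem integral_euler_mul_ge {a b : X → ℝ} (ha : MemLp a 2 ν) (hb : MemLp b 2 ν)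
    {τ : ℝ} (hτ : 0 < τ) :
    (∫ x, a x ^ 2 ∂ν) - (∫ x, b x ^ 2 ∂ν) ≤ 2 * τ * ∫ x, (a x - b x) / τ * a x ∂ν := by
  have hl : Integrable (fun x => (a x - b x) / τ * a x) ν := by
    have h : MemLp (fun x => τ⁻¹ * (a x - b x)) 2 ν := (ha.sub hb).const_mul τ⁻¹
    refine (h.integrable_mul ha).congr (.of_forall fun x => ?_)
    simp only [Pi.mul_apply]
    ring
  rw [← integral_const_mul, ← integral_sub ha.integrable_sq hb.integrable_sq]
  refine integral_mono (ha.integrable_sq.sub hb.integrable_sq) (hl.const_mul _) fun x => ?_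
  dsimp only
  have h1 : 2 * τ * ((a x - b x) / τ * a x) = 2 * ((a x - b x) * a x) := by field_simp
  rw [h1]
  nlinarith [sq_nonneg (a x - b x)]

theorem integral_sq_mul_le_eLpNorm_top {c u : X → ℝ} (hc : MemLp c ⊤ ν) (hu : MemLp u 2 ν) :
    ∫ x, (c x * u x) ^ 2 ∂ν ≤ (eLpNorm c ⊤ ν).toReal ^ 2 * ∫ x, u x ^ 2 ∂ν := by
  rw [← integral_const_mul]
  refine integral_mono_of_nonneg (.of_forall fun x => sq_nonneg _)
    (hu.integrable_sq.const_mul _) ?_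
  filter_upwards [ae_le_eLpNormEssSup (f := c) (μ := ν)] with x hx
  rw [← eLpNorm_exponent_top] at hx
  have h1 : |c x| ≤ (eLpNorm c ⊤ ν).toReal := by
    simpa using ENNReal.toReal_mono hc.2.ne hx
  rw [mul_pow, ← sq_abs (c x)]
  exact mul_le_mul_of_nonneg_right (pow_le_pow_left₀ (abs_nonneg _) h1 2) (sq_nonneg _)

end Integral

/-! ### An implicit discrete Gronwall inequality -/

/-- At each level the implicit loss 1 − a and the explicit gain 1 + b combine into the factor 1/(1 −
(a + b)), itself at most exp((a + b)/(1 − (a + b))). T is carried along with coefficient one. -/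
theorem discrete_gronwall {n : ℕ} {E T D a b G : ℕ → ℝ} (ha : ∀ j, 0 ≤ a j) (hb : ∀ j, 0 ≤ b j)
    (hab : ∀ j < n, a j + b j < 1) (hE : ∀ j < n, 0 ≤ E j) (hT : ∀ j < n, 0 ≤ T j)
    (hD : ∀ j, D j ≤ D (j + 1)) (hG0 : G 0 = Real.exp ((a 0 + b 0) / (1 - (a 0 + b 0))))
    (hG : ∀ j, G (j + 1) = G j * Real.exp ((a (j + 1) + b (j + 1)) / (1 - (a (j + 1) + b (j + 1)))))
    (h0 : E 0 * (1 - a 0) + T 0 ≤ D 0)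
    (hstep : ∀ j, j + 1 < n → E (j + 1) * (1 - a (j + 1)) + T (j + 1) ≤
      (1 + b j) * E j + T j + (D (j + 1) - D j)) :
    ∀ j < n, E j + T j ≤ D j * G j := by
  have hexp : ∀ j < n, 1 ≤ (1 - (a j + b j)) * Real.exp ((a j + b j) / (1 - (a j + b j))) := by
    intro j hj
    have h1 : 0 < 1 - (a j + b j) := by linarith [hab j hj]
    calc (1 : ℝ) = (1 - (a j + b j)) * ((a j + b j) / (1 - (a j + b j)) + 1) := by
          field_simp; ring
      _ ≤ _ := mul_le_mul_of_nonneg_left (Real.add_one_le_exp _) h1.le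
  have hmain : ∀ j < n, ∀ R, 0 ≤ R → E j * (1 - a j) + T j ≤ R →
      (1 + b j) * E j + T j ≤ R * Real.exp ((a j + b j) / (1 - (a j + b j))) := by
    intro j hj R hR h
    set g := a j + b j with hg
    have h1 : 0 < 1 - g := by linarith [hab j hj]
    have h2 : ((1 + b j) * E j + T j) * (1 - g) ≤ R := by
      refine le_trans ?_ h
      -- With g = a + b the left side equals 1 − a − b g.
      have h3 : (1 + b j) * (1 - g) ≤ 1 - a j := by
        rw [hg]; nlinarith [ha j, hb j, mul_nonneg (ha j) (hb j), sq_nonneg (b j)]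
      have h4 := mul_le_mul_of_nonneg_right h3 (hE j hj)
      have h5 : T j * (1 - g) ≤ T j := by
        nlinarith [hT j hj, mul_nonneg (hT j hj) (add_nonneg (ha j) (hb j))]
      nlinarith
    have h6 : (1 + b j) * E j + T j ≤ R / (1 - g) := (le_div_iff₀ h1).2 h2
    refine h6.trans ?_
    rw [div_le_iff₀ h1]
    have := mul_le_mul_of_nonneg_left (hexp j hj) hR
    rw [← hg] at this
    linarith
  have hGpos : ∀ j, 1 ≤ n → j < n → 1 ≤ G j := by
    intro j h1 hj
    have hone : ∀ j < n, 1 ≤ Real.exp ((a j + b j) / (1 - (a j + b j))) := fun j hj =>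
      Real.one_le_exp (div_nonneg (add_nonneg (ha j) (hb j)) (by linarith [hab j hj]))
    induction j with
    | zero => rw [hG0]; exact hone 0 hj
    | succ j ih =>
      rw [hG]
      exact one_le_mul_of_one_le_of_one_le (ih (by omega)) (hone _ hj)
  have hD0 : 1 ≤ n → ∀ j, 0 ≤ D j := by
    intro h1 j
    induction j with
    | zero =>
      refine le_trans ?_ h0
      have : 0 ≤ 1 - a 0 := by linarith [hab 0 h1, hb 0]
      exact add_nonneg (mul_nonneg (hE 0 h1) this) (hT 0 h1)
    | succ j ih => exact ih.trans (hD j)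
  -- The induction carries the factor 1 + b, since this is exactly the quantity on the right of the
  -- next step; it is dropped only at the end.
  have key : ∀ j < n, (1 + b j) * E j + T j ≤ D j * G j := by
    intro j hj
    induction j with
    | zero => rw [hG0]; exact hmain 0 hj _ (hD0 (by omega) 0) h0
    | succ j ih =>
      have hn : 1 ≤ n := by omega
      rw [hG, ← mul_assoc]
      refine hmain (j + 1) hj _ (mul_nonneg (hD0 hn _)
        (zero_le_one.trans (hGpos j hn (by omega)))) ?_
      refine (hstep j hj).trans ?_
      have h1 := ih (by omega)
      have h2 : D (j + 1) - D j ≤ (D (j + 1) - D j) * G j :=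
        le_mul_of_one_le_right (sub_nonneg.2 (hD j)) (hGpos j hn (by omega))
      linarith
  intro j hj
  have := key j hj
  nlinarith [mul_nonneg (hb j) (hE j hj)]

/-! ### Coercivity of the scheme and bound on the load -/

namespace SchemeData

variable {d N : ℕ}

/-- The assumptions on the coefficients, the source and the stabilization parameters at one time
level. -/
structure IsAdmissible (P : SchemeData d N) (μ cinv : ℝ) (n : ℕ) : Prop where
  b_lipschitz : LocallyLipschitzOn (P.motion.domain n) (P.b (P.time n))
  b_bounded : ∃ C : ℝ, ∀ x ∈ P.motion.domain n, ‖P.b (P.time n) x‖ ≤ C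
  c_memLp : MemLp (P.c (P.time n)) ⊤ (volume.restrict (P.motion.domain n))
  f_memLp : MemLp (P.f (P.time n)) 2 (volume.restrict (P.motion.domain n))
  coercive : ∀ᵐ x ∂(volume.restrict (P.motion.domain n)),
    μ ≤ P.c (P.time n) x - 1 / 2 * divergence (P.b (P.time n)) x
  inverse_inequality : ∀ v ∈ P.motion.feSpace P.k n, ∀ K ∈ P.motion.ref.cells,
    Metric.diam (P.motion.cell n K) ^ 2 *
        ∫ x in P.motion.cell n K, Laplacian.laplacian v x ^ 2 ≤
      cinv ^ 2 * ∫ x in P.motion.cell n K, ‖gradient v x‖ ^ 2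
  δ_nonneg : ∀ K ∈ P.motion.ref.cells, 0 ≤ P.δ n K
  δ_le_reaction : ∀ K ∈ P.motion.ref.cells,
    2 * (eLpNorm (P.c (P.time n)) ⊤ (volume.restrict (P.motion.cell n K))).toReal ^ 2 *
      P.δ n K ≤ μ
  δ_le_diffusion : ∀ K ∈ P.motion.ref.cells,
    2 * P.ε * cinv ^ 2 * P.δ n K ≤ Metric.diam (P.motion.cell n K) ^ 2
  δ_le_timeStep : ∀ K ∈ P.motion.ref.cells, P.δ n K ≤ P.Δt / 4

variable {P : SchemeData d N} {μ cinv : ℝ} {m : ℕ} {v : Space d → ℝ}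

theorem IsAdmissible.memLp_streamline (H : P.IsAdmissible μ cinv (m + 1)) (hm : m < N)
    (hv : v ∈ P.motion.feSpace P.k (m + 1)) :
    MemLp (P.streamline (m + 1) v) 2 (volume.restrict (P.motion.domain (m + 1))) := by
  have h := P.motion.isDeformation_map (Nat.succ_le_of_lt hm) (by omega)
  have hres : volume.restrict (interior (P.motion.domain (m + 1))) =
      volume.restrict (P.motion.domain (m + 1)) :=
    Measure.restrict_congr_set h.interior_imageDomain_ae_eq
  have hbm : AEStronglyMeasurable (P.b (P.time (m + 1)))
      (volume.restrict (P.motion.domain (m + 1))) := by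
    rw [← hres]
    exact (H.b_lipschitz.continuousOn.mono interior_subset).aestronglyMeasurable
      isOpen_interior.measurableSet
  have hw := P.motion.continuousOnCells_velocity hm P.Δt
  obtain ⟨C₁, hC₁⟩ := H.b_bounded
  obtain ⟨C₂, hC₂⟩ := h.exists_bound hw
  obtain ⟨C₃, hC₃⟩ := ALEMotion.exists_bound_gradient h hv
  refine h.memLp_top_of_bound (C := (C₁ + C₂) * C₃)
    ((hbm.sub (h.memLp hw 2).1).inner (measurable_gradient v).aestronglyMeasurable) ?_ 2
  filter_upwards [hC₃, ALEMotion.ae_mem_interior_domain h] with x hx hxi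
  have hb := hC₁ x (interior_subset hxi)
  have hw := hC₂ x (subset_closure (interior_subset hxi))
  refine (norm_inner_le_norm _ _).trans (mul_le_mul ((norm_sub_le _ _).trans (add_le_add hb hw))
    hx (norm_nonneg _) ?_)
  exact add_nonneg ((norm_nonneg _).trans hb) ((norm_nonneg _).trans hw)

theorem diam_imageCell_pos {T : Triangulation d} {φ : Space d → Space d}
    {K : Finset (Space d)} (hd : 0 < d) (h : T.IsDeformation φ) (hK : K ∈ T.cells) :
    0 < Metric.diam (imageCell φ K) := by
  have : Nonempty (Fin d) := ⟨⟨0, hd⟩⟩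
  have : Nontrivial (Space d) := inferInstance
  refine Metric.diam_pos (not_subsingleton_iff.1 fun hsub => ?_) (h.isCompact_imageCell hK).isBounded
  have hpos := (isOpen_interior.measure_pos volume (h.interior_imageCell_nonempty hK)).trans_le
    (measure_mono interior_subset)
  rw [hsub.measure_zero volume] at hpos
  exact lt_irrefl _ hpos

/-- After Young's inequality the squares of εΔv and cv remain; the diffusive bound on δ with the
inverse inequality controls the first, and the reactive bound the second. -/
theorem IsAdmissible.stabilization_ge (H : P.IsAdmissible μ cinv (m + 1)) (hd : 0 < d)
    (hε : 0 < P.ε) (hm : m < N) (hv : v ∈ P.motion.feSpace P.k (m + 1)) {K : Finset (Space d)}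
    (hK : K ∈ P.motion.ref.cells) :
    1 / 2 * (P.δ (m + 1) K * ∫ x in P.motion.cell (m + 1) K, P.streamline (m + 1) v x ^ 2) -
        P.ε / 2 * (∫ x in P.motion.cell (m + 1) K, ‖gradient v x‖ ^ 2) -
        μ / 2 * (∫ x in P.motion.cell (m + 1) K, v x ^ 2) ≤
      P.δ (m + 1) K * ∫ x in P.motion.cell (m + 1) K,
        (-P.ε * Laplacian.laplacian v x + P.streamline (m + 1) v x +
          P.c (P.time (m + 1)) x * v x) * P.streamline (m + 1) v x := by
  have h := P.motion.isDeformation_map (Nat.succ_le_of_lt hm) (by omega)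
  have hle : volume.restrict (P.motion.cell (m + 1) K) ≤
      volume.restrict (P.motion.domain (m + 1)) := h.restrict_imageCell_le hK
  have hs := (H.memLp_streamline hm hv).mono_measure hle
  have hL := (ALEMotion.memLp_laplacian h hv 2).mono_measure hle
  have hvL := (h.memLp (ALEMotion.continuousOnCells_of_mem_feSpace h hv) 2).mono_measure hle
  have hc := H.c_memLp.mono_measure hle
  have hcv : MemLp (fun x => P.c (P.time (m + 1)) x * v x) 2
      (volume.restrict (P.motion.cell (m + 1) K)) := hvL.mul' hc
  have h1 := integral_residual_mul_ge (hL.const_mul (-P.ε)) hs hcv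
  have h2 := integral_sq_mul_le_eLpNorm_top hc hvL
  have hinv := H.inverse_inequality v hv K hK
  have hδ0 := H.δ_nonneg K hK
  have hδc := H.δ_le_reaction K hK
  have hδh := H.δ_le_diffusion K hK
  have hdiam : 0 < Metric.diam (P.motion.cell (m + 1) K) := diam_imageCell_pos hd h hK
  simp only [mul_pow, neg_sq] at h1
  rw [integral_const_mul] at h1
  simp only [mul_pow] at h2
  set S := ∫ x in P.motion.cell (m + 1) K, P.streamline (m + 1) v x ^ 2
  set Λ := ∫ x in P.motion.cell (m + 1) K, Laplacian.laplacian v x ^ 2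
  set Γ := ∫ x in P.motion.cell (m + 1) K, ‖gradient v x‖ ^ 2
  set V := ∫ x in P.motion.cell (m + 1) K, v x ^ 2
  set Q := ∫ x in P.motion.cell (m + 1) K, P.c (P.time (m + 1)) x ^ 2 * v x ^ 2
  set δ := P.δ (m + 1) K
  set D := Metric.diam (P.motion.cell (m + 1) K)
  set c' := (eLpNorm (P.c (P.time (m + 1))) ⊤
    (volume.restrict (P.motion.cell (m + 1) K))).toReal
  have hΓ : 0 ≤ Γ := integral_nonneg fun _ => sq_nonneg _
  have hV : 0 ≤ V := integral_nonneg fun _ => sq_nonneg _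
  have hQ : δ * Q ≤ μ / 2 * V := by
    have h3 := mul_le_mul_of_nonneg_left h2 hδ0
    have h4 := mul_le_mul_of_nonneg_right hδc hV
    linarith
  -- The inverse inequality carries the squared diameter on its left, so the estimate is proved
  -- after multiplication by it; the diameter is positive because d > 0.
  have hΛ : δ * (P.ε ^ 2 * Λ) ≤ P.ε / 2 * Γ := by
    have hD2 : 0 < D ^ 2 := by positivity
    refine le_of_mul_le_mul_left ?_ hD2
    have h3 := mul_le_mul_of_nonneg_left hinv (mul_nonneg hδ0 (sq_nonneg P.ε))
    have h4 := mul_le_mul_of_nonneg_right hδh (mul_nonneg (half_pos hε).le hΓ)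
    nlinarith
  have h5 := mul_le_mul_of_nonneg_left h1 hδ0
  nlinarith

theorem IsAdmissible.tripleNormSq_nonneg (H : P.IsAdmissible μ cinv (m + 1)) (hε : 0 < P.ε)
    (hμ : 0 < μ) : 0 ≤ P.tripleNormSq μ (m + 1) v := by
  refine add_nonneg (add_nonneg (mul_nonneg hε.le (integral_nonneg fun _ => sq_nonneg _))
    (Finset.sum_nonneg fun K hK => mul_nonneg (H.δ_nonneg K hK)
      (integral_nonneg fun _ => sq_nonneg _)))
    (mul_nonneg hμ.le (P.motion.normSq_nonneg _ _))

/-- Coercivity of the spatial form. -/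
theorem IsAdmissible.spatialForm_ge (H : P.IsAdmissible μ cinv (m + 1)) (hd : 0 < d)
    (hΔt : 0 < P.Δt) (hε : 0 < P.ε) (hm : m < N) (hv : v ∈ P.motion.feSpace P.k (m + 1)) :
    1 / 2 * P.tripleNormSq μ (m + 1) v -
        1 / 2 * P.motion.alpha₁ P.Δt (m + 1) * P.motion.normSq (m + 1) v ≤
      P.spatialForm (m + 1) v v := by
  have h := P.motion.isDeformation_map (Nat.succ_le_of_lt hm) (by omega)
  obtain ⟨C, hC⟩ := H.b_bounded
  have h1 := ALEMotion.convection_reaction_feSpace h hv (H.b_lipschitz.mono interior_subset)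
    (fun x hx => hC x (interior_subset hx)) H.c_memLp H.coercive
  have h2 := P.motion.mesh_velocity_term_le hm hΔt hv
  have h3 := Finset.sum_le_sum fun K hK => H.stabilization_ge hd hε hm hv (K := K) hK
  rw [Finset.sum_sub_distrib, Finset.sum_sub_distrib, ← Finset.mul_sum, ← Finset.mul_sum,
    ← Finset.mul_sum] at h3
  have hg : ∫ x in P.motion.domain (m + 1), ‖gradient v x‖ ^ 2 =
      ∑ K ∈ P.motion.ref.cells, ∫ x in P.motion.cell (m + 1) K, ‖gradient v x‖ ^ 2 :=
    h.integral_imageDomain (ALEMotion.memLp_gradient h hv 2).norm.integrable_sq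
  have hvv : P.motion.normSq (m + 1) v =
      ∑ K ∈ P.motion.ref.cells, ∫ x in P.motion.cell (m + 1) K, v x ^ 2 :=
    h.integral_imageDomain
      (h.memLp (ALEMotion.continuousOnCells_of_mem_feSpace h hv) 2).integrable_sq
  rw [← hg, ← hvv] at h3
  simp only [spatialForm, aSUPG, tripleNormSq, real_inner_self_eq_norm_sq]
  linarith

/-- Young with weight μ for the plain term and weight 1 for the streamline term, where δ ≤ Δt/4
turns δ‖f‖² into the Δt/4 of the constant. -/
theorem IsAdmissible.load_le (H : P.IsAdmissible μ cinv (m + 1)) (hε : 0 < P.ε)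
    (hμ : 0 < μ) (hm : m < N) (hv : v ∈ P.motion.feSpace P.k (m + 1)) :
    P.load (m + 1) v ≤ (1 / μ + P.Δt / 4) * P.motion.normSq (m + 1) (P.f (P.time (m + 1))) +
      1 / 4 * P.tripleNormSq μ (m + 1) v := by
  have h := P.motion.isDeformation_map (Nat.succ_le_of_lt hm) (by omega)
  have h1 := integral_mul_le_weighted H.f_memLp
    (h.memLp (ALEMotion.continuousOnCells_of_mem_feSpace h hv) 2) hμ
  have h2 : ∀ K ∈ P.motion.ref.cells, P.δ (m + 1) K * ∫ x in P.motion.cell (m + 1) K,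
      P.f (P.time (m + 1)) x * P.streamline (m + 1) v x ≤
      P.Δt / 4 * (∫ x in P.motion.cell (m + 1) K, P.f (P.time (m + 1)) x ^ 2) +
      1 / 4 * (P.δ (m + 1) K * ∫ x in P.motion.cell (m + 1) K,
        P.streamline (m + 1) v x ^ 2) := by
    intro K hK
    have hle : volume.restrict (P.motion.cell (m + 1) K) ≤
      volume.restrict (P.motion.domain (m + 1)) := h.restrict_imageCell_le hK
    have h3 := integral_mul_le_weighted (H.f_memLp.mono_measure hle)
      ((H.memLp_streamline hm hv).mono_measure hle) one_pos
    have h4 := mul_le_mul_of_nonneg_left h3 (H.δ_nonneg K hK)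
    have h5 : 0 ≤ ∫ x in P.motion.cell (m + 1) K, P.f (P.time (m + 1)) x ^ 2 :=
      integral_nonneg fun _ => sq_nonneg _
    have h6 := mul_le_mul_of_nonneg_right (H.δ_le_timeStep K hK) h5
    linarith
  have h3 := Finset.sum_le_sum h2
  rw [Finset.sum_add_distrib, ← Finset.mul_sum, ← Finset.mul_sum] at h3
  have hf : P.motion.normSq (m + 1) (P.f (P.time (m + 1))) =
      ∑ K ∈ P.motion.ref.cells, ∫ x in P.motion.cell (m + 1) K, P.f (P.time (m + 1)) x ^ 2 :=
    h.integral_imageDomain H.f_memLp.integrable_sq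
  rw [← hf] at h3
  have h4 : 0 ≤ P.ε * (∫ x in P.motion.domain (m + 1), ‖gradient v x‖ ^ 2) :=
    mul_nonneg hε.le (integral_nonneg fun _ => sq_nonneg _)
  simp only [load, tripleNormSq]
  simp only [ALEMotion.normSq] at h3 ⊢
  change _ ≤ _ at h1
  have h5 : 1 / 4 * (μ * ∫ x in P.motion.domain (m + 1), v x ^ 2) =
      μ / 4 * ∫ x in P.motion.domain (m + 1), v x ^ 2 := by ring
  nlinarith [h1, h3, h4, h5]

end SchemeData

/-! ### Composition of transfers between time levels -/

namespace ALEMotion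

variable {d N : ℕ} (M : ALEMotion d N)

theorem ae_transfer_transfer {m n l : ℕ} (hm : m ≤ N) (hn : n ≤ N) (hN : 0 < N) :
    ∀ᵐ x ∂(volume.restrict (M.domain n)),
      M.transfer m l (M.transfer n m x) = M.transfer n l x := by
  have hn' := M.isDeformation_map hn hN
  have hm' := M.isDeformation_map hm hN
  refine hn'.ae_imageDomain_iff.2 fun K hK => ?_
  filter_upwards [ae_restrict_mem (hn'.measurableSet_imageCell hK)] with x hx
  have hY := Triangulation.simplex_subset_region hK (hn'.inverse_mem hK hx)
  change M.map l (M.ref.inverse (M.map m) (M.map m (M.ref.inverse (M.map n) x))) = _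
  rw [hm'.inverse_apply hY]
  rfl

end ALEMotion

/-! ### Energy inequalities of single steps and their accumulation -/

namespace SchemeData

variable {d N : ℕ} {P : SchemeData d N} {μ cinv : ℝ} {m : ℕ} {u : ℕ → Space d → ℝ}

theorem extrapolationSq_nonneg (u : ℕ → Space d → ℝ) (n : ℕ) : 0 ≤ P.extrapolationSq u n :=
  P.motion.normSq_nonneg _ _

/-- The energy inequality of one BDF-2 step. -/
theorem IsAdmissible.bdf2_step (H : P.IsAdmissible μ cinv (m + 2)) (hd : 0 < d)
    (hΔt : 0 < P.Δt) (hε : 0 < P.ε) (hμ : 0 < μ) (hm : m + 1 < N)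
    (hu : ∀ n ≤ N, u n ∈ P.motion.feSpace P.k n) (hB : P.IsBDF2Step u (m + 1)) :
    P.motion.normSq (m + 2) (u (m + 2)) + P.extrapolationSq u (m + 1) +
        P.Δt * P.tripleNormSq μ (m + 2) (u (m + 2)) ≤
      (1 + P.Δt * P.motion.alpha₂ P.Δt (m + 1)) *
          (P.motion.normSq (m + 1) (u (m + 1)) + P.extrapolationSq u m) +
        2 * P.Δt * P.motion.alpha₁ P.Δt (m + 2) * P.motion.normSq (m + 2) (u (m + 2)) +
        2 * P.Δt * ((2 / μ + P.Δt / 2) * P.motion.normSq (m + 2) (P.f (P.time (m + 2)))) := by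
  have hN : 0 < N := by omega
  have h₀ := P.motion.isDeformation_map (n := m) (by omega) hN
  have h₁ := P.motion.isDeformation_map (n := m + 1) (by omega) hN
  have h₂ := P.motion.isDeformation_map (n := m + 2) (by omega) hN
  have c₀ := ALEMotion.continuousOnCells_of_mem_feSpace h₀ (hu m (by omega))
  have c₁ := ALEMotion.continuousOnCells_of_mem_feSpace h₁ (hu (m + 1) (by omega))
  have c₂ := ALEMotion.continuousOnCells_of_mem_feSpace h₂ (hu (m + 2) (by omega))
  have hv := hu (m + 2) (by omega)
  have heq := hB (u (m + 2)) hv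
  have hge := H.spatialForm_ge hd hΔt hε hm hv
  have hle := H.load_le hε hμ hm hv
  have htime := integral_bdf2_mul_ge (h₂.memLp c₂ 2)
    (h₂.memLp (h₁.continuousOnCells_transfer h₂ c₁) 2)
    (h₂.memLp (h₀.continuousOnCells_transfer h₂ c₀) 2) hΔt
  have ht1 := P.motion.normSq_transfer_le hm hΔt c₁
  -- The extrapolation 2u^{m+1} − u^m is transported as one function on the domain at level m + 1.
  -- The next lines identify the transfer of u^m in two stages with the direct one.
  have hcext : P.motion.ref.ContinuousOnCells (P.motion.map (m + 1))
      (fun x => 2 * u (m + 1) x - u m (P.motion.transfer (m + 1) m x)) := fun K hK =>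
    ((c₁ K hK).const_mul 2).sub (h₀.continuousOnCells_transfer h₁ c₀ K hK)
  have ht2 := P.motion.normSq_transfer_le hm hΔt hcext
  have ht3 : P.motion.normSq (m + 2) (fun x =>
      2 * u (m + 1) (P.motion.transfer (m + 2) (m + 1) x) -
        u m (P.motion.transfer (m + 1) m (P.motion.transfer (m + 2) (m + 1) x))) =
      P.motion.normSq (m + 2) (fun x =>
      2 * u (m + 1) (P.motion.transfer (m + 2) (m + 1) x) -
        u m (P.motion.transfer (m + 2) m x)) := by
    refine integral_congr_ae ?_
    filter_upwards [P.motion.ae_transfer_transfer (m := m + 1) (n := m + 2) (l := m)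
      (by omega) (by omega) hN] with x hx
    rw [hx]
  have ht2' : P.motion.normSq (m + 2) (fun x =>
      2 * u (m + 1) (P.motion.transfer (m + 2) (m + 1) x) -
        u m (P.motion.transfer (m + 2) m x)) ≤
      (1 + P.Δt * P.motion.alpha₂ P.Δt (m + 1)) * P.extrapolationSq u m := ht3 ▸ ht2
  have htime' : P.motion.normSq (m + 2) (u (m + 2)) + P.extrapolationSq u (m + 1) -
      P.motion.normSq (m + 2) (fun x => u (m + 1) (P.motion.transfer (m + 2) (m + 1) x)) -
      P.motion.normSq (m + 2) (fun x =>
      2 * u (m + 1) (P.motion.transfer (m + 2) (m + 1) x) -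
        u m (P.motion.transfer (m + 2) m x)) ≤
      4 * P.Δt * ∫ x in P.motion.domain (m + 2),
        (3 / 2 * u (m + 2) x - 2 * u (m + 1) (P.motion.transfer (m + 2) (m + 1) x) +
        1 / 2 * u m (P.motion.transfer (m + 2) m x)) / P.Δt * u (m + 2) x := htime
  set I := ∫ x in P.motion.domain (m + 2),
        (3 / 2 * u (m + 2) x - 2 * u (m + 1) (P.motion.transfer (m + 2) (m + 1) x) +
        1 / 2 * u m (P.motion.transfer (m + 2) m x)) / P.Δt * u (m + 2) x
  have heq' : I + P.spatialForm (m + 2) (u (m + 2)) (u (m + 2)) = P.load (m + 2) (u (m + 2)) := heq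
  have hI : I ≤ (1 / μ + P.Δt / 4) * P.motion.normSq (m + 2) (P.f (P.time (m + 2))) -
      1 / 4 * P.tripleNormSq μ (m + 2) (u (m + 2)) +
      1 / 2 * P.motion.alpha₁ P.Δt (m + 2) * P.motion.normSq (m + 2) (u (m + 2)) := by
    linarith
  -- The factor 4Δt of the BDF-2 identity turns the remaining ¼|||u|||² into Δt|||u|||².
  have hI2 := mul_le_mul_of_nonneg_left hI (mul_nonneg zero_le_four hΔt.le)
  have hid : 4 * P.Δt * ((1 / μ + P.Δt / 4) * P.motion.normSq (m + 2) (P.f (P.time (m + 2))) -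
      1 / 4 * P.tripleNormSq μ (m + 2) (u (m + 2)) +
      1 / 2 * P.motion.alpha₁ P.Δt (m + 2) * P.motion.normSq (m + 2) (u (m + 2))) =
      2 * P.Δt * ((2 / μ + P.Δt / 2) * P.motion.normSq (m + 2) (P.f (P.time (m + 2)))) -
      P.Δt * P.tripleNormSq μ (m + 2) (u (m + 2)) +
      2 * P.Δt * P.motion.alpha₁ P.Δt (m + 2) * P.motion.normSq (m + 2) (u (m + 2)) := by
    ring
  linarith

/-- The energy inequality of one implicit Euler step. -/
theorem IsAdmissible.euler_step (H : P.IsAdmissible μ cinv (m + 1)) (hd : 0 < d)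
    (hΔt : 0 < P.Δt) (hε : 0 < P.ε) (hμ : 0 < μ) (hm : m < N)
    (hu : ∀ n ≤ N, u n ∈ P.motion.feSpace P.k n) (hE : P.IsEulerStep u m) :
    P.motion.normSq (m + 1) (u (m + 1)) + P.Δt / 2 * P.tripleNormSq μ (m + 1) (u (m + 1)) ≤
      (1 + P.Δt * P.motion.alpha₂ P.Δt m) * P.motion.normSq m (u m) +
        P.Δt * P.motion.alpha₁ P.Δt (m + 1) * P.motion.normSq (m + 1) (u (m + 1)) +
        P.Δt * ((2 / μ + P.Δt / 2) * P.motion.normSq (m + 1) (P.f (P.time (m + 1)))) := by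
  have hN : 0 < N := by omega
  have h₀ := P.motion.isDeformation_map (n := m) (by omega) hN
  have h₁ := P.motion.isDeformation_map (n := m + 1) (by omega) hN
  have c₀ := ALEMotion.continuousOnCells_of_mem_feSpace h₀ (hu m (by omega))
  have c₁ := ALEMotion.continuousOnCells_of_mem_feSpace h₁ (hu (m + 1) (by omega))
  have hv := hu (m + 1) (by omega)
  have heq := hE (u (m + 1)) hv
  have hge := H.spatialForm_ge hd hΔt hε hm hv
  have hle := H.load_le hε hμ hm hv
  have htime : P.motion.normSq (m + 1) (u (m + 1)) -
      P.motion.normSq (m + 1) (fun x => u m (P.motion.transfer (m + 1) m x)) ≤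
      2 * P.Δt * ∫ x in P.motion.domain (m + 1),
        (u (m + 1) x - u m (P.motion.transfer (m + 1) m x)) / P.Δt * u (m + 1) x :=
    integral_euler_mul_ge (h₁.memLp c₁ 2)
      (h₁.memLp (h₀.continuousOnCells_transfer h₁ c₀) 2) hΔt
  have ht := P.motion.normSq_transfer_le hm hΔt c₀
  set I := ∫ x in P.motion.domain (m + 1),
        (u (m + 1) x - u m (P.motion.transfer (m + 1) m x)) / P.Δt * u (m + 1) x
  have hI : I ≤ (1 / μ + P.Δt / 4) * P.motion.normSq (m + 1) (P.f (P.time (m + 1))) -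
      1 / 4 * P.tripleNormSq μ (m + 1) (u (m + 1)) +
      1 / 2 * P.motion.alpha₁ P.Δt (m + 1) * P.motion.normSq (m + 1) (u (m + 1)) := by
    linarith
  have hI2 := mul_le_mul_of_nonneg_left hI (mul_nonneg zero_le_two hΔt.le)
  have hid : 2 * P.Δt * ((1 / μ + P.Δt / 4) * P.motion.normSq (m + 1) (P.f (P.time (m + 1))) -
      1 / 4 * P.tripleNormSq μ (m + 1) (u (m + 1)) +
      1 / 2 * P.motion.alpha₁ P.Δt (m + 1) * P.motion.normSq (m + 1) (u (m + 1))) =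
      P.Δt * ((2 / μ + P.Δt / 2) * P.motion.normSq (m + 1) (P.f (P.time (m + 1)))) -
      P.Δt / 2 * P.tripleNormSq μ (m + 1) (u (m + 1)) +
      P.Δt * P.motion.alpha₁ P.Δt (m + 1) * P.motion.normSq (m + 1) (u (m + 1)) := by
    ring
  linarith

/-- Convexity of the square applied to u¹ = ½u⁰ + ½(2u¹ − u⁰), followed by transport of u⁰. -/
theorem normSq_one_le (hN : 0 < N) (hΔt : 0 < P.Δt)
    (hu : ∀ n ≤ N, u n ∈ P.motion.feSpace P.k n) :
    P.motion.normSq 1 (u 1) ≤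
      1 / 2 * (1 + P.Δt * P.motion.alpha₂ P.Δt 0) * P.motion.normSq 0 (u 0) +
        1 / 2 * P.extrapolationSq u 0 := by
  have h₀ := P.motion.isDeformation_map (n := 0) (by omega) hN
  have h₁ := P.motion.isDeformation_map (n := 1) (by omega) hN
  have c₀ := ALEMotion.continuousOnCells_of_mem_feSpace h₀ (hu 0 (by omega))
  have c₁ := ALEMotion.continuousOnCells_of_mem_feSpace h₁ (hu 1 (by omega))
  have ht : P.motion.normSq 1 (fun x => u 0 (P.motion.transfer 1 0 x)) ≤
      (1 + P.Δt * P.motion.alpha₂ P.Δt 0) * P.motion.normSq 0 (u 0) :=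
    P.motion.normSq_transfer_le hN hΔt c₀
  have m₁ := h₁.memLp c₁ 2
  have m₀ : MemLp (fun x => u 0 (P.motion.transfer 1 0 x)) 2
      (volume.restrict (P.motion.domain 1)) := h₁.memLp (h₀.continuousOnCells_transfer h₁ c₀) 2
  have m₂ : MemLp (fun x => 2 * u 1 x - u 0 (P.motion.transfer 1 0 x)) 2
      (volume.restrict (P.motion.domain 1)) := (m₁.const_mul 2).sub m₀
  have key : P.motion.normSq 1 (u 1) ≤
      1 / 2 * P.motion.normSq 1 (fun x => u 0 (P.motion.transfer 1 0 x)) +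
        1 / 2 * P.extrapolationSq u 0 := by
    simp only [extrapolationSq, ALEMotion.normSq, zero_add]
    rw [← integral_const_mul, ← integral_const_mul,
      ← integral_add (m₀.integrable_sq.const_mul _) (m₂.integrable_sq.const_mul _)]
    refine integral_mono m₁.integrable_sq
      ((m₀.integrable_sq.const_mul _).add (m₂.integrable_sq.const_mul _)) fun x => ?_
    dsimp only
    nlinarith [sq_nonneg (2 * u 1 x - 2 * u 0 (P.motion.transfer 1 0 x))]
  linarith

theorem growthFactor_succ (P : SchemeData d N) (n : ℕ) : P.growthFactor (n + 1) =
    P.growthFactor n * Real.exp (P.Δt * P.growth (n + 1) / (1 - P.Δt * P.growth (n + 1))) := by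
  rw [growthFactor, growthFactor, Finset.sum_Icc_succ_top (Nat.le_add_left 1 n), mul_add,
    Real.exp_add, mul_div_assoc]

/-- Accumulation of the energy inequalities of the BDF-2 steps. -/
theorem energy_le (hd : 0 < d) (hΔt : 0 < P.Δt) (hε : 0 < P.ε) (hμ : 0 < μ)
    (H : ∀ n < N, P.IsAdmissible μ cinv (n + 1)) (hstep : ∀ n ≤ N, P.Δt * P.growth n < 1)
    (hu : ∀ n ≤ N, u n ∈ P.motion.feSpace P.k n)
    (hBDF : ∀ n, 1 ≤ n → n < N → P.IsBDF2Step u n) {T₀ D₀ : ℝ} (hT₀ : 0 ≤ T₀)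
    (h₀ : (P.motion.normSq 1 (u 1) + P.extrapolationSq u 0) + T₀ ≤
      D₀ + 2 * P.Δt * P.motion.alpha₁ P.Δt 1 * P.motion.normSq 1 (u 1)) :
    ∀ n < N, P.motion.normSq (n + 1) (u (n + 1)) + P.extrapolationSq u n +
        (T₀ + P.Δt * ∑ i ∈ Finset.Icc 2 (n + 1), P.tripleNormSq μ i (u i)) ≤
      (D₀ + 2 * P.Δt * ∑ i ∈ Finset.Icc 2 (n + 1),
        (2 / μ + P.Δt / 2) * P.motion.normSq i (P.f (P.time i))) * P.growthFactor (n + 1) := by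
  have hα₁ : ∀ n, 0 ≤ 2 * P.Δt * P.motion.alpha₁ P.Δt n := fun n =>
    mul_nonneg (by positivity) (P.motion.alpha₁_nonneg _ _)
  have hα₂ : ∀ n, 0 ≤ P.Δt * P.motion.alpha₂ P.Δt n := fun n =>
    mul_nonneg hΔt.le (P.motion.alpha₂_nonneg _ _)
  have hgr : ∀ n, P.Δt * P.growth n =
      2 * P.Δt * P.motion.alpha₁ P.Δt n + P.Δt * P.motion.alpha₂ P.Δt n := fun n => by
    rw [growth]; ring
  have hsucc : ∀ j, Finset.Icc 2 (j + 1 + 1) = insert (j + 2) (Finset.Icc 2 (j + 1)) := fun j => by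
    ext i; simp only [Finset.mem_Icc, Finset.mem_insert]; omega
  have hsum : ∀ (F : ℕ → ℝ) (j : ℕ), ∑ i ∈ Finset.Icc 2 (j + 1 + 1), F i =
      ∑ i ∈ Finset.Icc 2 (j + 1), F i + F (j + 2) := fun F j => by
    rw [hsucc, Finset.sum_insert (by simp), add_comm]
  have hF : ∀ i, 0 ≤ (2 / μ + P.Δt / 2) * P.motion.normSq i (P.f (P.time i)) := fun i =>
    mul_nonneg (by positivity) (P.motion.normSq_nonneg _ _)
  -- Index j stands for level j + 1. Here b j belongs to the motion leaving that level, hence α₁ and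
  -- α₂ of the same level meet in the growth factor, while α₂⁰ is left to the initial data.
  refine discrete_gronwall (a := fun j => 2 * P.Δt * P.motion.alpha₁ P.Δt (j + 1))
    (b := fun j => P.Δt * P.motion.alpha₂ P.Δt (j + 1))
    (E := fun j => P.motion.normSq (j + 1) (u (j + 1)) + P.extrapolationSq u j)
    (T := fun j => T₀ + P.Δt * ∑ i ∈ Finset.Icc 2 (j + 1), P.tripleNormSq μ i (u i))
    (D := fun j => D₀ + 2 * P.Δt * ∑ i ∈ Finset.Icc 2 (j + 1),
        (2 / μ + P.Δt / 2) * P.motion.normSq i (P.f (P.time i)))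
    (G := fun j => P.growthFactor (j + 1)) (fun j => hα₁ _) (fun j => hα₂ _) ?_ ?_ ?_ ?_ ?_ ?_ ?_ ?_
  · intro j hj
    rw [← hgr]
    exact hstep _ hj
  · exact fun j _ => add_nonneg (P.motion.normSq_nonneg _ _) (extrapolationSq_nonneg _ _)
  · intro j hj
    refine add_nonneg hT₀ (mul_nonneg hΔt.le (Finset.sum_nonneg fun i hi => ?_))
    obtain ⟨hi1, hi2⟩ := Finset.mem_Icc.1 hi
    obtain ⟨l, rfl⟩ := Nat.exists_eq_add_of_le' (show 1 ≤ i by omega)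
    exact (H l (by omega)).tripleNormSq_nonneg hε hμ
  · intro j
    simp only [hsum]
    have := mul_nonneg (mul_nonneg zero_le_two hΔt.le) (hF (j + 2))
    linarith
  · rw [← hgr, zero_add, growthFactor]
    simp [mul_div_assoc]
  · intro j
    rw [growthFactor_succ, ← hgr]
  -- The Gronwall lemma lets α₁ multiply the whole energy, whereas the estimate has it on ‖u‖² only;
  -- the surplus on the extrapolation term is nonnegative.
  · have h2 := mul_nonneg (hα₁ 1) (extrapolationSq_nonneg (P := P) u 0)
    simp only [zero_add, Finset.Icc_eq_empty_of_lt one_lt_two, Finset.sum_empty, mul_zero,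
      add_zero]
    linarith
  · intro j hj
    have h1 := (H (j + 1) hj).bdf2_step hd hΔt hε hμ hj hu (hBDF (j + 1) (by omega) hj)
    have h2 := mul_nonneg (hα₁ (j + 2)) (extrapolationSq_nonneg (P := P) u (j + 1))
    simp only [hsum]
    have e : j + 1 + 1 = j + 2 := rfl
    rw [e]
    linarith

end SchemeData

end ALESUPG

end

/-! ### The stability lemma -/

open ALESUPG in
theorem mainTheorem3 {d N : ℕ} (hd : d = 2 ∨ d = 3) (P : SchemeData d N) (μ cinv : ℝ)
    (hΔt : 0 < P.Δt) (hε : 0 < P.ε) (hμ : 0 < μ)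
    -- regularity of the coefficients and of the source at the time levels
    (hbLip : ∀ n, 1 ≤ n → n ≤ N → LocallyLipschitzOn (P.motion.domain n) (P.b (P.time n)))
    (hbBdd : ∀ n, 1 ≤ n → n ≤ N →
      ∃ C : ℝ, ∀ x ∈ P.motion.domain n, ‖P.b (P.time n) x‖ ≤ C)
    (hc : ∀ n, 1 ≤ n → n ≤ N →
      MemLp (P.c (P.time n)) ⊤ (volume.restrict (P.motion.domain n)))
    (hf : ∀ n, 1 ≤ n → n ≤ N →
      MemLp (P.f (P.time n)) 2 (volume.restrict (P.motion.domain n)))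
    -- discrete version of `c - (1/2) ∇·b ≥ μ`
    (hcoer : ∀ n, 1 ≤ n → n ≤ N → ∀ᵐ x ∂(volume.restrict (P.motion.domain n)),
      μ ≤ P.c (P.time n) x - 1 / 2 * divergence (P.b (P.time n)) x)
    -- conditions on the stabilization parameters
    (hcinv : P.motion.IsInverseConstant P.k cinv)
    (hδ0 : ∀ n, 1 ≤ n → n ≤ N → ∀ K ∈ P.motion.ref.cells, 0 ≤ P.δ n K)
    (hδc : ∀ n, 1 ≤ n → n ≤ N → ∀ K ∈ P.motion.ref.cells,
      2 * (eLpNorm (P.c (P.time n)) ⊤ (volume.restrict (P.motion.cell n K))).toReal ^ 2 *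
        P.δ n K ≤ μ)
    (hδh : ∀ n, 1 ≤ n → n ≤ N → ∀ K ∈ P.motion.ref.cells,
      2 * P.ε * cinv ^ 2 * P.δ n K ≤ Metric.diam (P.motion.cell n K) ^ 2)
    (hδt : ∀ n, 1 ≤ n → n ≤ N → ∀ K ∈ P.motion.ref.cells, P.δ n K ≤ P.Δt / 4)
    -- time step restriction
    (hstep : ∀ n ≤ N, P.Δt * P.growth n < 1)
    -- the BDF-2 solution
    (u : ℕ → Space d → ℝ)
    (hu : ∀ n ≤ N, u n ∈ P.motion.feSpace P.k n)
    (hBDF : ∀ n, 1 ≤ n → n < N → P.IsBDF2Step u n) :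
    -- arbitrary starting values
    (∀ n < N,
      P.motion.normSq (n + 1) (u (n + 1)) + P.extrapolationSq u n +
          P.Δt * ∑ i ∈ Finset.Icc 2 (n + 1), P.tripleNormSq μ i (u i) ≤
        (1 / 2 * (1 + P.Δt * P.motion.alpha₂ P.Δt 0) * P.motion.normSq 0 (u 0) +
          3 / 2 * P.extrapolationSq u 0 +
          2 * P.Δt * ∑ i ∈ Finset.Icc 2 (n + 1),
            (2 / μ + P.Δt / 2) * P.motion.normSq i (P.f (P.time i))) *
          P.growthFactor (n + 1)) ∧
    -- the first step made with the implicit Euler scheme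
    (P.IsEulerStep u 0 → ∀ n < N,
      P.motion.normSq (n + 1) (u (n + 1)) + P.extrapolationSq u n +
          P.Δt / 2 * P.tripleNormSq μ 1 (u 1) +
          P.Δt * ∑ i ∈ Finset.Icc 2 (n + 1), P.tripleNormSq μ i (u i) ≤
        ((1 + P.Δt * P.motion.alpha₂ P.Δt 0) * P.motion.normSq 0 (u 0) +
          P.extrapolationSq u 0 +
          2 * P.Δt * ∑ i ∈ Finset.Icc 1 (n + 1),
            (2 / μ + P.Δt / 2) * P.motion.normSq i (P.f (P.time i))) *
          P.growthFactor (n + 1)) := by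
  have hd0 : 0 < d := by omega
  have H : ∀ n < N, P.IsAdmissible μ cinv (n + 1) := fun n hn =>
    have h1 : 1 ≤ n + 1 := Nat.le_add_left 1 n
    { b_lipschitz := hbLip _ h1 hn
      b_bounded := hbBdd _ h1 hn
      c_memLp := hc _ h1 hn
      f_memLp := hf _ h1 hn
      coercive := hcoer _ h1 hn
      inverse_inequality := hcinv _ h1 hn
      δ_nonneg := hδ0 _ h1 hn
      δ_le_reaction := hδc _ h1 hn
      δ_le_diffusion := hδh _ h1 hn
      δ_le_timeStep := hδt _ h1 hn }
  have hα₁ : ∀ x, 0 ≤ x → 0 ≤ P.Δt * P.motion.alpha₁ P.Δt 1 * x := fun x hx =>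
    mul_nonneg (mul_nonneg hΔt.le (P.motion.alpha₁_nonneg _ _)) hx
  constructor
  · intro n hn
    have hN : 0 < N := by omega
    have h1 := SchemeData.normSq_one_le hN hΔt hu
    have h2 := hα₁ _ (P.motion.normSq_nonneg 1 (u 1))
    -- Convexity contributes ½ of the extrapolation term, and the starting energy contains it once
    -- more: this is the 3/2.
    have key := SchemeData.energy_le hd0 hΔt hε hμ H hstep hu hBDF (T₀ := 0)
      (D₀ := 1 / 2 * (1 + P.Δt * P.motion.alpha₂ P.Δt 0) * P.motion.normSq 0 (u 0) +
          3 / 2 * P.extrapolationSq u 0) le_rfl (by linarith) n hn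
    rwa [zero_add] at key
  · intro hE n hn
    have hN : 0 < N := by omega
    have h1 := (H 0 hN).euler_step hd0 hΔt hε hμ hN hu hE
    have h2 := hα₁ _ (P.motion.normSq_nonneg 1 (u 1))
    have h3 : 0 ≤ P.Δt * ((2 / μ + P.Δt / 2) * P.motion.normSq 1 (P.f (P.time 1))) :=
      mul_nonneg hΔt.le (mul_nonneg (by positivity) (P.motion.normSq_nonneg _ _))
    -- The Euler step produces Δt α₁ and a single Δt before the source; both are doubled to match
    -- the BDF-2 steps. T₀ keeps its dissipation on the left throughout.
    have key := SchemeData.energy_le hd0 hΔt hε hμ H hstep hu hBDF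
      (T₀ := P.Δt / 2 * P.tripleNormSq μ 1 (u 1))
      (D₀ := (1 + P.Δt * P.motion.alpha₂ P.Δt 0) * P.motion.normSq 0 (u 0) +
          P.extrapolationSq u 0 +
          2 * P.Δt * ((2 / μ + P.Δt / 2) * P.motion.normSq 1 (P.f (P.time 1))))
      (mul_nonneg (half_pos hΔt).le ((H 0 hN).tripleNormSq_nonneg hε hμ))
      (by simp only [zero_add] at h1; linarith) n hn
    have hsplit : Finset.Icc 1 (n + 1) = insert 1 (Finset.Icc 2 (n + 1)) := by
      ext i; simp only [Finset.mem_Icc, Finset.mem_insert]; omega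
    rw [hsplit, Finset.sum_insert (by simp), mul_add, ← add_assoc]
    rwa [← add_assoc] at key
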